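/- **The scrip game.** Fix a cost $\alpha\in[0,1)$, an ability probability $\beta\in(0,1]$ and a total amount of money $M\in\{1,2,\dots\}$. For a number of agents $n\ge 1$, a discount factor $0<\delta<1$ and an initial allocation of $M$ indivisible dollars to the $n$ agents, the game $G(n,\delta)=G(n,\delta,\alpha,\beta)$ is played in rounds $t=0,1,2,\dots$; write $K_i^t$ for the number of dollars of agent $i$ at the beginning of round $t$. In round $t$ a requester $p^t$ is drawn uniformly from the $n$ agents; independently, each agent $i$ is able to serve ($B_i^t=1$) with probability $\beta$ and unable ($B_i^t=0$) otherwise; and each agent $i$ decides whether to volunteer ($V_i^t=1$) or not ($V_i^t=0$). If $W^t=\{j\ne p^t : V_j^tB_j^t=1\}$ is nonempty, an agent $v^t$ drawn uniformly from $W^t$ fulfils the request; the round-$t$ utility $u_i^t$ is $1$ for $i=p^t$, $-\alpha$ for $i=v^t$ and $0$ for all others, and if moreover $K_{p^t}^t>0$ then $p^t$ pays one dollar to $v^t$. If $W^t=\emptyset$, all utilities are $0$ and no money moves. A strategy of an agent prescribes the (possibly randomized) decision to volunteer as an arbitrary function of the complete record of all past rounds, the current allocation of money and the current requester; the agents randomize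 independently. Agent $i$ maximizes the expectation of $U_i=\sum_{t\ge 0}\delta^{t/n}u_i^t$. A strategy profile is a Nash equilibrium if no agent can increase its expected utility by switching to any other strategy. For an integer $k\ge 0$, the threshold strategy $S_k$ of agent $i$ is to volunteer in round $t$ exactly when $K_{p^t}^t>0$ and $K_i^t<k$. **Theorem.** For all $\alpha\in[0,1)$, $\beta\in(0,1]$ and every integer $M\ge 1$ there exist $\delta^*<1$ and $n^*$ such that for all $\delta$ with $\delta^*<\delta<1$ and all $n>n^*$ there is an integer $\gamma>0$ such that, for every initial allocation of the $M$ dollars to the $n$ agents, the profile in which all agents play $S_\gamma$ is a Nash equilibrium of $G(n,\delta,\alpha,\beta)$. -/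

import Mathlib

namespace ScripGame

open Finset

/-- An allocation of money: `s i` is the number of dollars of agent `i`. -/
abbrev Alloc (n : ℕ) : Type := Fin n → ℕ

/-- A complete record `(p, B, V, v)` of one round: the requester `p`, the set `B` of agents that
are able to satisfy the request, the set `V` of agents that volunteer, and the agent `v` that
fulfils the request (`none` if nobody does). -/
abbrev Round (n : ℕ) : Type :=
  Fin n × Finset (Fin n) × Finset (Fin n) × Option (Fin n)

namespace Round

variable {n : ℕ}

/-- The agent making the request. -/
def requester (r : Round n) : Fin n := r.1

/-- The agents that are able to satisfy the request. -/
def able (r : Round n) : Finset (Fin n) := r.2.1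

/-- The agents that decide to volunteer. -/
def volunteers (r : Round n) : Finset (Fin n) := r.2.2.1

/-- The agent that fulfils the request, if any. -/
def server (r : Round n) : Option (Fin n) := r.2.2.2

/-- The agents other than the requester that are both willing and able. -/
def candidates (r : Round n) : Finset (Fin n) :=
  (r.volunteers ∩ r.able).erase r.requester

end Round

/-- The allocation after the round `r`, when it was `s` before: a requester who has money and at
least one candidate pays one dollar to the agent that fulfils the request. -/
def nextAlloc {n : ℕ} (s : Alloc n) (r : Round n) : Alloc n := fun i =>
  if i = r.requester ∧ r.candidates.Nonempty ∧ 0 < s i then s i - 1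
  else if r.server = some i ∧ 0 < s r.requester then s i + 1
  else s i

/-- A history of play: the list of all past rounds, the most recent one first. -/
abbrev History (n : ℕ) : Type := List (Round n)

/-- The current allocation after the history `h`, from the initial allocation `s₀`. -/
def money {n : ℕ} (s₀ : Alloc n) : History n → Alloc n
  | [] => s₀
  | r :: h => nextAlloc (money s₀ h) r

/-- A (randomized, history-dependent) strategy: given the records of all past rounds, the current
allocation of money and the current requester, the probability of volunteering. -/
abbrev Strategy (n : ℕ) : Type := History n → Alloc n → Fin n → unitInterval

/-- The threshold strategy `S_k` of agent `i`: volunteer exactly when the requester can pay and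
the agent itself has fewer than `k` dollars. -/
def threshold {n : ℕ} (k : ℕ) (i : Fin n) : Strategy n := fun _ s p =>
  if 0 < s p ∧ s i < k then 1 else 0

/-- The probability that the able set is `B`, all abilities being independent with
probability `β`. -/
def ableProb {n : ℕ} (β : ℝ) (B : Finset (Fin n)) : ℝ :=
  ∏ j, if j ∈ B then β else 1 - β

/-- The probability that the set of volunteers is `V`, when each agent `j` independently
volunteers with probability `q j`. -/
def volunteerProb {n : ℕ} (q : Fin n → ℝ) (V : Finset (Fin n)) : ℝ :=
  ∏ j, if j ∈ V then q j else 1 - q j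

/-- The probability that `v` is the chosen agent: uniform on the set `W` of candidates, and nobody
if there is no candidate. -/
noncomputable def serverProb {n : ℕ} (W : Finset (Fin n)) : Option (Fin n) → ℝ
  | none => if W = ∅ then 1 else 0
  | some j => if j ∈ W then 1 / (#W : ℝ) else 0

/-- The probability that the next round is `r`, given the history `h`, when the agents play the
strategy profile `σ` from the initial allocation `s₀`. -/
noncomputable def roundProb {n : ℕ} (β : ℝ) (s₀ : Alloc n) (σ : Fin n → Strategy n)
    (h : History n) (r : Round n) : ℝ :=
  1 / (n : ℝ) * ableProb β r.able *
    volunteerProb (fun j => (σ j h (money s₀ h) r.requester : ℝ)) r.volunteers *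
    serverProb r.candidates r.server

/-- The probability that the first `h.length` rounds of play are recorded by `h`. -/
noncomputable def historyProb {n : ℕ} (β : ℝ) (s₀ : Alloc n) (σ : Fin n → Strategy n) :
    History n → ℝ
  | [] => 1
  | r :: h => historyProb β s₀ σ h * roundProb β s₀ σ h r

/-- The utility of (standard) agent `i` in the round `r`. -/
noncomputable def roundUtility {n : ℕ} (α : ℝ) (i : Fin n) (r : Round n) : ℝ :=
  if i = r.requester ∧ r.candidates.Nonempty then 1
  else if r.server = some i then -α
  else 0

/-- The expected utility of agent `i` in round `t` (rounds are numbered from `0`). -/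
noncomputable def expectedRoundUtility {n : ℕ} (α β : ℝ) (s₀ : Alloc n)
    (σ : Fin n → Strategy n) (i : Fin n) (t : ℕ) : ℝ :=
  ∑ h : List.Vector (Round n) t, ∑ r : Round n,
    historyProb β s₀ σ h.toList * roundProb β s₀ σ h.toList r * roundUtility α i r

/-- The expected total utility of agent `i`, round `t` being discounted by `δ ^ (t / n)`. Since the
utilities of the rounds are bounded, the series converges absolutely for `0 ≤ δ < 1`, and it is the
expectation of the total discounted utility. -/
noncomputable def expectedUtility {n : ℕ} (δ α β : ℝ) (s₀ : Alloc n)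
    (σ : Fin n → Strategy n) (i : Fin n) : ℝ :=
  ∑' t : ℕ, δ ^ ((t : ℝ) / (n : ℝ)) * expectedRoundUtility α β s₀ σ i t

/-- The profile `σ` is a Nash equilibrium of the scrip game `G(n, δ, α, β)` with initial allocation
`s₀`: no agent can increase its expected utility by switching to any other strategy. -/
def IsNashEquilibrium {n : ℕ} (δ α β : ℝ) (s₀ : Alloc n) (σ : Fin n → Strategy n) : Prop :=
  ∀ (i : Fin n) (τ : Strategy n),
    expectedUtility δ α β s₀ (Function.update σ i τ) i ≤ expectedUtility δ α β s₀ σ i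

end ScripGame

namespace ScripGame

open Finset

/-! ### The law of a single round and its payments -/

section Round

variable {n : ℕ}

/-! The threshold is γ = M, whatever δ and n are. If the requester has a dollar, everybody else has
fewer than M, so under `threshold M` everybody volunteers exactly when the requester can pay. The
allocation is then a Markov chain that commutes with relabelling the agents: a funded `p` pays each
`j ≠ p` with the same probability c/n per round. Let V be the discounted value of this chain for
agent `i`, with per-round discount ρ = δ^(1/n). By the one-shot deviation principle
(`deviation_le_cooperativeValue` and `tsum_expectedRoundUtility_le`), equilibrium holds once
receiving a dollar beats its going elsewhere, or staying put, by at least α in discounted value.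

To compare V at two allocations, subtract `dollarValue`, the exact value of i's dollars if i never
served anybody. If θ is the expected discount until a funded agent is served, this is θ(1 + ρθ +
...), so one more dollar adds θ(ρθ)^a, at least (ρθ)^M. The remainder solves a discounted Poisson
equation whose source is at most cM/n, because at most M other agents can pay i.

The remainder oscillates by O(M²/n), uniformly in ρ (`abs_sub_le_of_poisson`); this uniformity lets
n* be chosen independently of δ. Indeed when n is large, dollars tend to spread out: call a dollar
misplaced if i holds it or it is stacked on another. The number M - `funded` of misplaced dollars
falls at a rate of order n, and the allocations with none misplaced are all equivalent under
permutations fixing i. A maximum principle with a multiple of this count as barrier gives the bound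
(`contact_bound`).

Thus a dollar is worth nearly 1 when δ is near 1 and n is large (`le_value_sub`), which exceeds α.
-/

lemma sum_volunteerProb (q : Fin n → ℝ) : ∑ V, volunteerProb q V = 1 := by
  have h := Finset.prod_add q (fun j => 1 - q j) univ
  simp only [add_sub_cancel, prod_const_one, powerset_univ] at h
  rw [h]
  refine sum_congr rfl fun V _ => ?_
  rw [volunteerProb, prod_ite]
  congr 1
  · exact prod_congr (by ext; simp) fun _ _ => rfl
  · exact prod_congr (by ext; simp) fun _ _ => rfl

lemma volunteerProb_nonneg {q : Fin n → ℝ} (h₀ : ∀ j, 0 ≤ q j) (h₁ : ∀ j, q j ≤ 1)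
    (V : Finset (Fin n)) : 0 ≤ volunteerProb q V :=
  prod_nonneg fun j _ => by
    split_ifs
    · exact h₀ j
    · exact sub_nonneg.2 (h₁ j)

lemma sum_ableProb (β : ℝ) : ∑ B : Finset (Fin n), ableProb β B = 1 :=
  sum_volunteerProb _

lemma ableProb_nonneg {β : ℝ} (h₀ : 0 ≤ β) (h₁ : β ≤ 1) (B : Finset (Fin n)) :
    0 ≤ ableProb β B :=
  volunteerProb_nonneg (fun _ => h₀) (fun _ => h₁) B

/-- Only agent `i` randomizes: the law of the set of volunteers is carried by two sets. -/
lemma sum_volunteerProb_mul {q : Fin n → ℝ} (i : Fin n) (T : Finset (Fin n))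
    (hq : ∀ j, j ≠ i → q j = if j ∈ T then 1 else 0) (g : Finset (Fin n) → ℝ) :
    ∑ V, volunteerProb q V * g V = q i * g (insert i T) + (1 - q i) * g (T.erase i) := by
  have hne : insert i T ≠ T.erase i := fun h => by
    have := mem_insert_self i T
    rw [h] at this
    simp at this
  rw [← sum_subset (subset_univ {insert i T, T.erase i}), sum_pair hne]
  · congr 2
    · rw [volunteerProb, prod_eq_single i]
      · simp
      · intro j _ hj
        rw [hq j hj]
        by_cases h : j ∈ T <;> simp [h, hj]
      · simp
    · rw [volunteerProb, prod_eq_single i]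
      · simp
      · intro j _ hj
        rw [hq j hj]
        by_cases h : j ∈ T <;> simp [h, hj]
      · simp
  · intro V _ hV
    have : ∃ j, j ≠ i ∧ ¬(j ∈ V ↔ j ∈ T) := by
      by_contra! hc
      apply hV
      simp only [mem_insert, mem_singleton]
      by_cases hi : i ∈ V
      · left
        ext j
        by_cases hj : j = i
        · simp [hj, hi]
        · simp [hj, hc j hj]
      · right
        ext j
        by_cases hj : j = i
        · simp [hj, hi]
        · simp [hj, hc j hj]
    obtain ⟨j, hj, hj'⟩ := this
    rw [volunteerProb, prod_eq_zero (mem_univ j), zero_mul]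
    rw [hq j hj]
    by_cases h1 : j ∈ V <;> by_cases h2 : j ∈ T <;> simp_all

lemma serverProb_nonneg (W : Finset (Fin n)) (v : Option (Fin n)) : 0 ≤ serverProb W v := by
  cases v <;> simp only [serverProb] <;> split_ifs <;> positivity

lemma sum_serverProb_mul (W : Finset (Fin n)) (φ : Option (Fin n) → ℝ) :
    ∑ v, serverProb W v * φ v =
      if W = ∅ then φ none else 1 / (#W : ℝ) * ∑ j ∈ W, φ (some j) := by
  rw [Fintype.sum_option]
  simp only [serverProb, ite_mul, zero_mul, one_mul, sum_ite_mem, univ_inter]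
  split_ifs with h
  · simp [h]
  · rw [zero_add, mul_sum]

lemma sum_serverProb (W : Finset (Fin n)) : ∑ v, serverProb W v = 1 := by
  have := sum_serverProb_mul W fun _ => 1
  simp only [mul_one, sum_const, nsmul_eq_mul] at this
  rw [this]
  split_ifs with h
  · rfl
  · have : (#W : ℝ) ≠ 0 := by simpa using h
    field_simp

/-- Expectations over one round, with the four draws in order. -/
lemma sum_roundProb_mul (β : ℝ) (s₀ : Alloc n) (σ : Fin n → Strategy n) (h : History n)
    (G : Round n → ℝ) :
    ∑ r, roundProb β s₀ σ h r * G r =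
      ∑ p, 1 / (n : ℝ) * ∑ B, ableProb β B *
        ∑ V, volunteerProb (fun j => (σ j h (money s₀ h) p : ℝ)) V *
          ∑ v, serverProb ((V ∩ B).erase p) v * G (p, B, V, v) := by
  simp only [Fintype.sum_prod_type, mul_sum]
  refine sum_congr rfl fun p _ => sum_congr rfl fun B _ => sum_congr rfl fun V _ =>
    sum_congr rfl fun v _ => ?_
  simp only [roundProb, Round.able, Round.requester, Round.volunteers, Round.server,
    Round.candidates]
  ring

lemma sum_roundProb (hn : 0 < n) (β : ℝ) (s₀ : Alloc n) (σ : Fin n → Strategy n)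
    (h : History n) : ∑ r, roundProb β s₀ σ h r = 1 := by
  have := sum_roundProb_mul β s₀ σ h fun _ => 1
  simp only [mul_one, sum_serverProb, sum_volunteerProb, sum_ableProb, sum_const, card_univ,
    Fintype.card_fin, nsmul_eq_mul] at this
  rw [this]
  field_simp

lemma roundProb_nonneg {β : ℝ} (h₀ : 0 ≤ β) (h₁ : β ≤ 1) (s₀ : Alloc n)
    (σ : Fin n → Strategy n) (h : History n) (r : Round n) : 0 ≤ roundProb β s₀ σ h r :=
  mul_nonneg (mul_nonneg (mul_nonneg (by positivity) (ableProb_nonneg h₀ h₁ _))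
    (volunteerProb_nonneg (fun j => (σ j _ _ _).2.1) (fun j => (σ j _ _ _).2.2) _))
    (serverProb_nonneg _ _)

/-- The allocation after `p` pays a dollar to `j`. -/
def pay (s : Alloc n) (p j : Fin n) : Alloc n := fun k =>
  s k - (if k = p then 1 else 0) + (if k = j then 1 else 0)

lemma pay_self {s : Alloc n} {p : Fin n} (hp : 0 < s p) : pay s p p = s := by
  funext k
  by_cases h : k = p
  · subst h; simp [pay]; omega
  · simp [pay, h]

lemma pay_comp (s : Alloc n) (p j : Fin n) (π : Equiv.Perm (Fin n)) :
    pay s (π p) (π j) ∘ π = pay (s ∘ π) p j := by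
  funext k
  simp [pay]

lemma pay_apply_requester {s : Alloc n} {p j : Fin n} (h : j ≠ p) : pay s p j p = s p - 1 := by
  simp [pay, h.symm]

lemma pay_apply_server {s : Alloc n} {p j : Fin n} (h : j ≠ p) : pay s p j j = s j + 1 := by
  simp [pay, h]

lemma pay_apply_of_ne {s : Alloc n} {p j k : Fin n} (hp : k ≠ p) (hj : k ≠ j) :
    pay s p j k = s k := by
  simp [pay, hp, hj]

lemma sum_pay {s : Alloc n} {p : Fin n} (hp : 0 < s p) (j : Fin n) :
    ∑ k, pay s p j k = ∑ k, s k := by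
  have h : ∑ k, (s k - if k = p then 1 else 0) + 1 = ∑ k, s k := by
    rw [← Finset.add_sum_erase _ _ (mem_univ p), ← Finset.add_sum_erase _ s (mem_univ p)]
    have : ∑ k ∈ univ.erase p, (s k - if k = p then 1 else 0) = ∑ k ∈ univ.erase p, s k :=
      sum_congr rfl fun k hk => by simp [(mem_erase.1 hk).1]
    rw [this]
    simp
    omega
  simp only [pay, sum_add_distrib]
  simpa using h

lemma nextAlloc_of_pos {s : Alloc n} {p j : Fin n} {B V : Finset (Fin n)} (hp : 0 < s p)
    (hj : j ∈ (V ∩ B).erase p) : nextAlloc s (p, B, V, some j) = pay s p j := by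
  have hne : ((V ∩ B).erase p).Nonempty := ⟨j, hj⟩
  have hjp : j ≠ p := (mem_erase.1 hj).1
  funext k
  simp only [nextAlloc, Round.requester, Round.candidates, Round.server, Round.volunteers,
    Round.able, hne, true_and, hp, and_true, Option.some.injEq]
  by_cases hk : k = p
  · subst hk
    simp [hp, pay, hjp.symm]
  · by_cases hkj : k = j
    · subst hkj; simp [pay, hk]
    · simp [pay, hk, hkj, Ne.symm hkj]

lemma nextAlloc_none {s : Alloc n} {p : Fin n} {B V : Finset (Fin n)}
    (h : (V ∩ B).erase p = ∅) : nextAlloc s (p, B, V, none) = s := by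
  funext k
  simp [nextAlloc, Round.requester, Round.candidates, Round.server, Round.volunteers,
    Round.able, h]

lemma nextAlloc_of_eq_zero {s : Alloc n} {p : Fin n} {B V : Finset (Fin n)}
    {v : Option (Fin n)} (hp : s p = 0) : nextAlloc s (p, B, V, v) = s := by
  funext k
  simp only [nextAlloc, Round.requester, Round.candidates, Round.server, Round.volunteers,
    Round.able, hp, lt_irrefl, and_false, if_false]
  split_ifs with h
  · obtain ⟨rfl, -, h⟩ := h
    omega
  · rfl

lemma sum_nextAlloc {β : ℝ} {s₀ : Alloc n} {σ : Fin n → Strategy n} {h : History n}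
    {r : Round n} (hr : roundProb β s₀ σ h r ≠ 0) (s : Alloc n) :
    ∑ k, nextAlloc s r k = ∑ k, s k := by
  obtain ⟨p, B, V, v⟩ := r
  have hv := right_ne_zero_of_mul hr
  simp only [Round.candidates, Round.requester, Round.able, Round.volunteers, Round.server] at hv
  rcases Nat.eq_zero_or_pos (s p) with hp | hp
  · rw [nextAlloc_of_eq_zero hp]
  · cases v with
    | none =>
      simp only [serverProb, ne_eq, ite_eq_right_iff, one_ne_zero, imp_false, not_not] at hv
      rw [nextAlloc_none hv]
    | some j =>
      by_cases hj : j ∈ (V ∩ B).erase p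
      · rw [nextAlloc_of_pos hp hj, sum_pay hp]
      · simp only [serverProb, if_neg hj] at hv
        exact absurd rfl hv

lemma sum_money {β : ℝ} {s₀ : Alloc n} {σ : Fin n → Strategy n} {h : History n}
    (hh : historyProb β s₀ σ h ≠ 0) : ∑ k, money s₀ h k = ∑ k, s₀ k := by
  induction h with
  | nil => rfl
  | cons r h ih =>
    rw [historyProb] at hh
    rw [money, sum_nextAlloc (right_ne_zero_of_mul hh), ih (left_ne_zero_of_mul hh)]

/-! ### Values of one round with a given continuation -/

/-- What agent `i` gets if `j` serves `p`, with continuation value `V` discounted by `ρ`. -/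
noncomputable def serviceValue (α ρ : ℝ) (i : Fin n) (V : Alloc n → ℝ) (s : Alloc n)
    (p j : Fin n) : ℝ :=
  (if i = p then 1 else if j = i then -α else 0) + ρ * V (pay s p j)

/-- What agent `i` expects if the set of candidates for serving `p`, who can pay, is `W`. -/
noncomputable def candidatesValue (α ρ : ℝ) (i : Fin n) (V : Alloc n → ℝ) (s : Alloc n)
    (p : Fin n) (W : Finset (Fin n)) : ℝ :=
  ρ * V s + 1 / (#W : ℝ) * ∑ j ∈ W, (serviceValue α ρ i V s p j - ρ * V s)

lemma sum_serverProb_of_pos (α ρ : ℝ) (i : Fin n) (F : Alloc n → ℝ) {s : Alloc n} {p : Fin n}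
    (hp : 0 < s p) (B V : Finset (Fin n)) :
    ∑ v, serverProb ((V ∩ B).erase p) v *
      (roundUtility α i (p, B, V, v) + ρ * F (nextAlloc s (p, B, V, v))) =
      candidatesValue α ρ i F s p ((V ∩ B).erase p) := by
  rw [sum_serverProb_mul, candidatesValue]
  split_ifs with h
  -- Without candidates the average in `candidatesValue` is 1/0 times an empty sum, which leaves `ρ
  -- * F s` as it should.
  · rw [h, nextAlloc_none h]
    simp [roundUtility, Round.candidates, Round.requester, Round.volunteers, Round.able, h,
      Round.server]
  · have hc : (#((V ∩ B).erase p) : ℝ) ≠ 0 := by simpa using h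
    rw [sum_sub_distrib, sum_const, nsmul_eq_mul, mul_sub]
    have : 1 / (#((V ∩ B).erase p) : ℝ) * (#((V ∩ B).erase p) * (ρ * F s)) = ρ * F s := by
      field_simp
    rw [this, add_sub_cancel]
    congr 1
    refine sum_congr rfl fun j hj => ?_
    have hne : ((V ∩ B).erase p).Nonempty := ⟨j, hj⟩
    rw [nextAlloc_of_pos hp hj, serviceValue]
    simp [roundUtility, Round.candidates, Round.requester, Round.volunteers, Round.able, hne,
      Round.server]

/-- Serving for free costs α ≥ 0 and moves no money, so it cannot help. -/
lemma sum_serverProb_of_eq_zero {α : ℝ} (hα : 0 ≤ α) (ρ : ℝ) {i : Fin n} (F : Alloc n → ℝ)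
    {s : Alloc n} {p : Fin n} (hp : s p = 0) (hi : i ≠ p) (B V : Finset (Fin n)) :
    ∑ v, serverProb ((V ∩ B).erase p) v *
      (roundUtility α i (p, B, V, v) + ρ * F (nextAlloc s (p, B, V, v))) ≤ ρ * F s := by
  calc _ ≤ ∑ v, serverProb ((V ∩ B).erase p) v * (ρ * F s) := by
        refine sum_le_sum fun v _ => mul_le_mul_of_nonneg_left ?_ (serverProb_nonneg _ _)
        rw [nextAlloc_of_eq_zero hp]
        simp only [roundUtility, Round.requester, hi, false_and, if_false]
        split_ifs <;> linarith
    _ = ρ * F s := by rw [← sum_mul, sum_serverProb, one_mul]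

lemma sum_serverProb_of_empty (α ρ : ℝ) (i : Fin n) (F : Alloc n → ℝ)
    (s : Alloc n) {p : Fin n} {B V : Finset (Fin n)} (h : (V ∩ B).erase p = ∅) :
    ∑ v, serverProb ((V ∩ B).erase p) v *
      (roundUtility α i (p, B, V, v) + ρ * F (nextAlloc s (p, B, V, v))) = ρ * F s := by
  rw [sum_serverProb_mul, if_pos h, nextAlloc_none h]
  simp [roundUtility, Round.candidates, Round.requester, Round.volunteers, Round.able, h,
      Round.server]

/-! ### Service probabilities and their symmetry -/

/-- The probability that `j` serves `p` when everybody volunteers. -/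
noncomputable def serviceProb (β : ℝ) (p j : Fin n) : ℝ :=
  ∑ B : Finset (Fin n), ableProb β B *
    if j ∈ B.erase p then 1 / (#(B.erase p) : ℝ) else 0

lemma serviceProb_perm (β : ℝ) (p j : Fin n) (π : Equiv.Perm (Fin n)) :
    serviceProb β (π p) (π j) = serviceProb β p j := by
  refine (Fintype.sum_equiv (Equiv.finsetCongr π) _ _ fun B => ?_).symm
  have h1 : ((Equiv.finsetCongr π) B).erase (π p) = (B.erase p).map π.toEmbedding := by
    ext k
    simp only [Equiv.finsetCongr_apply, mem_erase, mem_map_equiv]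
    rw [ne_eq, ne_eq, Equiv.symm_apply_eq]
  rw [h1, card_map]
  congr 1
  · rw [ableProb, ableProb,
      ← Equiv.prod_comp π (fun k => if k ∈ (Equiv.finsetCongr π) B then β else 1 - β)]
    simp
  · simp

lemma serviceProb_self (β : ℝ) (p : Fin n) : serviceProb β p p = 0 := by
  simp [serviceProb]

/-- Permutations act transitively on ordered pairs of distinct agents, and abilities are
exchangeable. Hence a single constant c describes the whole chain. -/
lemma serviceProb_eq (β : ℝ) {p j p' j' : Fin n} (h : p ≠ j) (h' : p' ≠ j') :
    serviceProb β p j = serviceProb β p' j' := by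
  have : ∃ π : Equiv.Perm (Fin n), π p = p' ∧ π j = j' := by
    refine ⟨(Equiv.swap p p').trans (Equiv.swap (Equiv.swap p p' j) j'), ?_, ?_⟩
    · rw [Equiv.trans_apply, Equiv.swap_apply_left, Equiv.swap_apply_of_ne_of_ne _ h']
      intro hc
      rw [eq_comm, Equiv.swap_apply_eq_iff, Equiv.swap_apply_right] at hc
      exact h hc.symm
    · rw [Equiv.trans_apply, Equiv.swap_apply_left]
  obtain ⟨π, rfl, rfl⟩ := this
  rw [serviceProb_perm]

lemma sum_serviceProb (β : ℝ) (p : Fin n) :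
    ∑ j, serviceProb β p j =
      ∑ B : Finset (Fin n), ableProb β B * if B.erase p = ∅ then 0 else 1 := by
  simp only [serviceProb]
  rw [sum_comm]
  refine sum_congr rfl fun B _ => ?_
  rw [← mul_sum, sum_ite_mem, univ_inter, sum_const, nsmul_eq_mul]
  split_ifs with h
  · simp [h]
  · have hc : (#(B.erase p) : ℝ) ≠ 0 := by simpa using h
    field_simp

lemma sum_serviceProb_le_one {β : ℝ} (h₀ : 0 ≤ β) (h₁ : β ≤ 1) (p : Fin n) :
    ∑ j, serviceProb β p j ≤ 1 := by
  rw [sum_serviceProb]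
  refine (sum_le_sum fun B _ => ?_).trans (sum_ableProb (n := n) β).le
  refine mul_le_of_le_one_right (ableProb_nonneg h₀ h₁ B) ?_
  split_ifs <;> norm_num

/-- Expand the product of β + (1 - β) over all agents with the term 1 - β deleted at `j`: the sets
without `j` drop out, and the product is β. -/
lemma sum_ableProb_mem (β : ℝ) (j : Fin n) :
    ∑ B : Finset (Fin n), ableProb β B * (if j ∈ B then 1 else 0) = β := by
  have h := Finset.prod_add (fun _ => β) (fun k : Fin n => if k = j then 0 else 1 - β) univ
  have h2 : ∏ k : Fin n, (β + if k = j then 0 else 1 - β) = β := by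
    rw [prod_eq_single j] <;> simp +contextual
  rw [h2, powerset_univ] at h
  refine Eq.trans ?_ h.symm
  refine sum_congr rfl fun B _ => ?_
  rw [ableProb, prod_ite]
  by_cases hj : j ∈ B
  · simp only [hj, if_true, mul_one]
    congr 1
    · exact prod_congr (by ext; simp) fun _ _ => rfl
    · refine prod_congr (by ext; simp) fun k hk => ?_
      rw [if_neg]
      rintro rfl
      simp [hj] at hk
  · simp only [hj, if_false, mul_zero]
    rw [prod_eq_zero (mem_sdiff.2 ⟨mem_univ j, hj⟩) (by simp), mul_zero]

lemma le_sum_serviceProb {β : ℝ} (h₀ : 0 ≤ β) (h₁ : β ≤ 1) {p j : Fin n} (h : j ≠ p) :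
    β ≤ ∑ j, serviceProb β p j := by
  rw [sum_serviceProb]
  conv_lhs => rw [← sum_ableProb_mem β j]
  refine sum_le_sum fun B _ => mul_le_mul_of_nonneg_left ?_ (ableProb_nonneg h₀ h₁ B)
  split_ifs with h1 h2 h2
  · exact absurd h2 (ne_empty_of_mem (mem_erase.2 ⟨h, h1⟩))
  all_goals norm_num

lemma serviceProb_nonneg {β : ℝ} (h₀ : 0 ≤ β) (h₁ : β ≤ 1) (p j : Fin n) :
    0 ≤ serviceProb β p j :=
  sum_nonneg fun B _ => mul_nonneg (ableProb_nonneg h₀ h₁ B) (by split_ifs <;> positivity)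

lemma sum_serviceProb_eq {β : ℝ} {p₀ j₀ : Fin n} (h : p₀ ≠ j₀) (p : Fin n) :
    ∑ j, serviceProb β p j = (n - 1 : ℝ) * serviceProb β p₀ j₀ := by
  rw [← add_sum_erase _ _ (mem_univ p), serviceProb_self, zero_add,
    sum_congr rfl (g := fun _ => serviceProb β p₀ j₀), sum_const, card_erase_of_mem (mem_univ p),
    card_univ, Fintype.card_fin, nsmul_eq_mul, Nat.cast_sub (Fin.pos p), Nat.cast_one]
  intro j hj
  exact serviceProb_eq β (mem_erase.1 hj).1.symm h

lemma sum_ableProb_candidatesValue (α β ρ : ℝ) (i : Fin n) (F : Alloc n → ℝ) (s : Alloc n)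
    (p : Fin n) :
    ∑ B, ableProb β B * candidatesValue α ρ i F s p (B.erase p) =
      ρ * F s + ∑ j, serviceProb β p j * (serviceValue α ρ i F s p j - ρ * F s) := by
  simp only [candidatesValue, mul_add, sum_add_distrib]
  rw [← sum_mul, sum_ableProb, one_mul]
  congr 1
  simp only [serviceProb, sum_mul]
  rw [sum_comm]
  refine sum_congr rfl fun B _ => ?_
  simp only [mul_assoc, ← mul_sum, ite_mul, zero_mul, sum_ite_mem, univ_inter]

/-- Staying out of the set of candidates does not help an agent that likes best to serve. -/
lemma candidatesValue_erase_le {α ρ : ℝ} {i : Fin n} {F : Alloc n → ℝ} {s : Alloc n} {p : Fin n}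
    (hp : 0 < s p) (hi : i ≠ p)
    (h : ∀ j, j ≠ i → ρ * F (pay s p j) ≤ -α + ρ * F (pay s p i))
    {W : Finset (Fin n)} (hW : i ∈ W) :
    candidatesValue α ρ i F s p (W.erase i) ≤ candidatesValue α ρ i F s p W := by
  -- The choice `j = p` stands for nobody serving, as paying oneself changes nothing; it covers the
  -- case in which `i` is the only candidate.
  have hs := h p hi.symm
  rw [pay_self hp] at hs
  have hj : ∀ j ∈ W.erase i, serviceValue α ρ i F s p j - ρ * F s ≤
      -α + ρ * F (pay s p i) - ρ * F s := by
    intro j hj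
    have := h j (mem_erase.1 hj).1
    simp only [serviceValue, hi, (mem_erase.1 hj).1, if_false]
    linarith
  have hsum := sum_le_card_nsmul _ _ _ hj
  rw [nsmul_eq_mul] at hsum
  have hii : serviceValue α ρ i F s p i - ρ * F s = -α + ρ * F (pay s p i) - ρ * F s := by
    simp [serviceValue, hi]
  simp only [candidatesValue]
  rw [← add_sum_erase W _ hW, hii]
  have hcard : (#W : ℝ) = #(W.erase i) + 1 := by
    exact_mod_cast (card_erase_add_one hW).symm
  rw [hcard]
  set S := ∑ j ∈ W.erase i, (serviceValue α ρ i F s p j - ρ * F s)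
  set X := -α + ρ * F (pay s p i) - ρ * F s
  have hX : 0 ≤ X := by simp only [X]; linarith
  rcases (W.erase i).eq_empty_or_nonempty with he | he
  · simp [S, he, hX]
  · have hc : (0 : ℝ) < #(W.erase i) := by exact_mod_cast he.card_pos
    rw [add_le_add_iff_left, one_div_mul_eq_div, one_div_mul_eq_div,
      div_le_div_iff₀ hc (by linarith)]
    nlinarith

/-! ### One-shot deviations from cooperation -/

/-- The expected value of a round when everybody volunteers iff the requester can pay. -/
noncomputable def cooperativeValue (α β ρ : ℝ) (i : Fin n) (F : Alloc n → ℝ) (s : Alloc n) : ℝ :=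
  ∑ p, 1 / (n : ℝ) * ∑ B, ableProb β B *
    if 0 < s p then candidatesValue α ρ i F s p (B.erase p) else ρ * F s

/-- The volunteers other than `i` under the threshold strategies. -/
def thresholdVolunteers (k : ℕ) (s : Alloc n) (p : Fin n) : Finset (Fin n) :=
  {j | 0 < s p ∧ s j < k}

/-- The requester holds one of the M dollars, so nobody else can reach the threshold M. -/
lemma thresholdVolunteers_of_pos {M : ℕ} {s : Alloc n} (hs : ∑ k, s k = M) {p j : Fin n}
    (hp : 0 < s p) (hj : j ≠ p) : j ∈ thresholdVolunteers M s p := by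
  simp only [thresholdVolunteers, mem_filter, mem_univ, true_and, hp]
  have := sum_le_sum_of_subset (f := s) (subset_univ {j, p})
  rw [sum_pair hj] at this
  omega

lemma sum_roundProb_update (β : ℝ) (s₀ : Alloc n) (i : Fin n) (τ : Strategy n) (M : ℕ)
    (h : History n) (G : Round n → ℝ) :
    ∑ r, roundProb β s₀ (Function.update (fun i : Fin n => threshold M i) i τ) h r * G r =
      ∑ p, 1 / (n : ℝ) * ∑ B, ableProb β B *
        ((τ h (money s₀ h) p : ℝ) * (∑ v, serverProb ((insert i
            (thresholdVolunteers M (money s₀ h) p) ∩ B).erase p) v *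
              G (p, B, insert i (thresholdVolunteers M (money s₀ h) p), v)) +
          (1 - (τ h (money s₀ h) p : ℝ)) * (∑ v, serverProb (((
            thresholdVolunteers M (money s₀ h) p).erase i ∩ B).erase p) v *
              G (p, B, (thresholdVolunteers M (money s₀ h) p).erase i, v))) := by
  rw [sum_roundProb_mul]
  refine sum_congr rfl fun p _ => ?_
  congr 1
  refine sum_congr rfl fun B _ => ?_
  congr 1
  rw [sum_volunteerProb_mul i (thresholdVolunteers M (money s₀ h) p)]
  · simp
  · intro j hj
    simp only [Function.update_of_ne hj, threshold, thresholdVolunteers, mem_filter, mem_univ,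
      true_and]
    split_ifs <;> simp

/-- One-shot deviation: if serving is always the best outcome for `i`, then being a candidate as
often as possible is optimal. In `hF` the case `j = p` means that nobody serves. -/
lemma deviation_le_cooperativeValue {α β ρ : ℝ} (hα : 0 ≤ α) (h₀ : 0 ≤ β) (h₁ : β ≤ 1)
    {F : Alloc n → ℝ} {s₀ : Alloc n} {i : Fin n} {M : ℕ} (τ : Strategy n)
    {h : History n} (hs : ∑ k, money s₀ h k = M)
    (hF : ∀ p j, 0 < money s₀ h p → p ≠ i → j ≠ i →
      ρ * F (pay (money s₀ h) p j) ≤ -α + ρ * F (pay (money s₀ h) p i)) :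
    ∑ r, roundProb β s₀ (Function.update (fun i : Fin n => threshold M i) i τ) h r *
      (roundUtility α i r + ρ * F (nextAlloc (money s₀ h) r)) ≤
      cooperativeValue α β ρ i F (money s₀ h) := by
  rw [sum_roundProb_update, cooperativeValue]
  refine sum_le_sum fun p _ => mul_le_mul_of_nonneg_left ?_ (by positivity)
  refine sum_le_sum fun B _ => mul_le_mul_of_nonneg_left ?_ (ableProb_nonneg h₀ h₁ B)
  set s := money s₀ h
  have hx₀ := (τ h s p).2.1
  have hx₁ := (τ h s p).2.2
  set x : ℝ := (τ h s p : ℝ)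
  -- The value is affine in the probability of volunteering, so only the two pure decisions matter.
  suffices H : ∀ a b c : ℝ, a ≤ c → b ≤ c → x * a + (1 - x) * b ≤ c by
    rcases Nat.eq_zero_or_pos (s p) with hp | hp
    · rw [if_neg (by omega)]
      have hT : thresholdVolunteers M s p = ∅ := by simp [thresholdVolunteers, hp]
      apply H
      · by_cases hi : i = p
        · refine (sum_serverProb_of_empty α ρ i F s ?_).le
          ext j
          simp [hT, hi]
          tauto
        · exact sum_serverProb_of_eq_zero hα ρ F hp hi _ _
      · exact (sum_serverProb_of_empty α ρ i F s (by simp [hT])).le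
    · rw [if_pos hp, sum_serverProb_of_pos α ρ i F hp, sum_serverProb_of_pos α ρ i F hp]
      have hT : ∀ j, j ≠ p → j ∈ thresholdVolunteers M s p := fun j hj =>
        thresholdVolunteers_of_pos hs hp hj
      have e1 : (insert i (thresholdVolunteers M s p) ∩ B).erase p = B.erase p := by
        ext j
        simp only [mem_erase, mem_inter, mem_insert]
        have := hT j
        tauto
      have e2 : ((thresholdVolunteers M s p).erase i ∩ B).erase p = (B.erase p).erase i := by
        ext j
        simp only [mem_erase, mem_inter]
        have := hT j
        tauto
      rw [e1, e2]
      apply H _ _ _ le_rfl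
      by_cases hi : i ∈ B.erase p
      · exact candidatesValue_erase_le hp (mem_erase.1 hi).1
          (fun j hj => hF p j hp (mem_erase.1 hi).1.symm hj) hi
      · rw [erase_eq_of_notMem hi]
  intro a b c ha hb
  nlinarith

/-- The profile itself is the deviation of `i` to its own strategy; the decision of `i` is
immaterial when `i` is the requester. -/
lemma sum_roundProb_threshold {α β ρ : ℝ} {F : Alloc n → ℝ} {s₀ : Alloc n} (i : Fin n) {M : ℕ}
    {h : History n} (hs : ∑ k, money s₀ h k = M) :
    ∑ r, roundProb β s₀ (fun i : Fin n => threshold M i) h r *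
      (roundUtility α i r + ρ * F (nextAlloc (money s₀ h) r)) =
      cooperativeValue α β ρ i F (money s₀ h) := by
  have := sum_roundProb_update β s₀ i (threshold M i) M h fun r =>
    roundUtility α i r + ρ * F (nextAlloc (money s₀ h) r)
  rw [Function.update_eq_self i (fun i : Fin n => threshold (n := n) M i)] at this
  rw [this, cooperativeValue]
  refine sum_congr rfl fun p _ => ?_
  congr 1
  refine sum_congr rfl fun B _ => ?_
  congr 1
  set s := money s₀ h
  rcases Nat.eq_zero_or_pos (s p) with hp | hp
  · have hT : thresholdVolunteers M s p = ∅ := by simp [thresholdVolunteers, hp]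
    rw [if_neg (by omega)]
    rw [sum_serverProb_of_empty α ρ i F s (V := (thresholdVolunteers M s p).erase i)
      (by simp [hT])]
    simp [threshold, hp]
  · rw [if_pos hp, sum_serverProb_of_pos α ρ i F hp, sum_serverProb_of_pos α ρ i F hp]
    have hT : ∀ j, j ≠ p → j ∈ thresholdVolunteers M s p := fun j hj =>
      thresholdVolunteers_of_pos hs hp hj
    have e1 : (insert i (thresholdVolunteers M s p) ∩ B).erase p = B.erase p := by
      ext j
      simp only [mem_erase, mem_inter, mem_insert]
      have := hT j
      tauto
    rw [e1]
    by_cases hi : i = p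
    · have e2 : ((thresholdVolunteers M s p).erase i ∩ B).erase p = B.erase p := by
        ext j
        simp only [mem_erase, mem_inter]
        have := hT j
        subst hi
        tauto
      rw [e2]
      ring
    · have := hT i hi
      simp only [thresholdVolunteers, mem_filter, mem_univ, true_and] at this
      simp [threshold, this]

/-- The operator `V ↦ ∑ (V (s - e_p + e_j) - V s)`, over the `p` that can pay and all `j`. -/
noncomputable def gen (F : Alloc n → ℝ) (s : Alloc n) : ℝ :=
  ∑ p, ∑ j, if 0 < s p then F (pay s p j) - F s else 0

/-- The number of agents other than `i` that have money. -/
def funded (i : Fin n) (s : Alloc n) : ℕ := #{p | p ≠ i ∧ 0 < s p}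

/-- The expected utility of agent `i` in one round, `c` being the probability of being served by
a given other agent. -/
noncomputable def reward (α c : ℝ) (i : Fin n) (s : Alloc n) : ℝ :=
  c / n * ((if 0 < s i then (n - 1 : ℝ) else 0) - α * funded i s)

/-- Since all services are equally likely, the Bellman operator of cooperation is a reward plus ρ
times `step`; its fixed point can be written as a discounted series. -/
lemma cooperativeValue_eq (α β ρ : ℝ) (i : Fin n) (F : Alloc n → ℝ) (s : Alloc n)
    {p₀ j₀ : Fin n} (h₀ : p₀ ≠ j₀) :
    cooperativeValue α β ρ i F s =
      reward α (serviceProb β p₀ j₀) i s +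
        ρ * (F s + serviceProb β p₀ j₀ / n * gen F s) := by
  set c := serviceProb β p₀ j₀
  have hn : (n : ℝ) ≠ 0 := by exact_mod_cast (Fin.pos i).ne'
  have hc : ∀ p j, p ≠ j → serviceProb β p j = c := fun p j h => serviceProb_eq β h h₀
  have key : ∀ p, (∑ B, ableProb β B *
      if 0 < s p then candidatesValue α ρ i F s p (B.erase p) else ρ * F s) =
      ρ * F s + c * ((if p = i then (if 0 < s i then (n - 1 : ℝ) else 0) else 0) -
        α * (if p ≠ i ∧ 0 < s p then 1 else 0) +
        ρ * ∑ j, if 0 < s p then F (pay s p j) - F s else 0) := by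
    intro p
    by_cases hp : 0 < s p
    · simp only [hp, if_true]
      rw [sum_ableProb_candidatesValue, add_right_inj]
      have h1 : ∀ j, serviceProb β p j * (serviceValue α ρ i F s p j - ρ * F s) =
          c * ((if i = p then (if j = p then 0 else 1) else 0) -
            α * (if i ≠ p ∧ j = i then 1 else 0) + ρ * (F (pay s p j) - F s)) := by
        intro j
        by_cases hj : j = p
        · subst hj
          rw [serviceProb_self, pay_self hp]
          by_cases hi : i = j
          · simp [hi]
          · simp [hi, Ne.symm hi]
        · rw [hc p j (Ne.symm hj)]
          by_cases hi : i = p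
          · subst hi; simp [serviceValue, hj]; ring_nf; simp
          · by_cases hji : j = i
            · subst hji; simp [serviceValue, hj]; ring_nf; simp
            · simp [serviceValue, hi, hji]; ring_nf; simp
      simp only [h1]
      rw [← mul_sum, sum_add_distrib, sum_sub_distrib, ← mul_sum, ← mul_sum]
      congr 2
      by_cases hi : p = i
      · subst hi
        simp only [hp, if_true, ne_eq, not_true_eq_false, false_and, if_false, sum_const_zero]
        congr 1
        rw [← add_sum_erase _ _ (mem_univ p), if_pos rfl, zero_add,
          sum_congr rfl (g := fun _ => (1 : ℝ)), sum_const, card_erase_of_mem (mem_univ p),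
          card_univ, Fintype.card_fin, nsmul_eq_mul, Nat.cast_sub (Fin.pos p), Nat.cast_one,
          mul_one]
        intro j hj
        rw [if_neg (mem_erase.1 hj).1]
      · simp [hi, Ne.symm hi]
    · simp only [hp, if_false]
      rw [← sum_mul, sum_ableProb, one_mul]
      by_cases hi : p = i
      · subst hi; simp [hp]
      · simp [hi]
  rw [cooperativeValue]
  simp only [key]
  rw [← mul_sum, sum_add_distrib, ← mul_sum univ _ c, sum_add_distrib, sum_sub_distrib,
    ← mul_sum univ _ α, sum_const, card_univ, Fintype.card_fin, nsmul_eq_mul,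
    ← mul_sum univ _ ρ, reward, gen, funded,
    sum_ite_eq' univ i, if_pos (mem_univ i), sum_boole]
  field_simp
  ring

end Round

/-! ### The cooperative Markov chain and its discounted value -/

section Chain

variable {n : ℕ}

lemma gen_neg (F : Alloc n → ℝ) (s : Alloc n) : gen (fun s => -F s) s = -gen F s := by
  simp only [gen, ← sum_neg_distrib]
  refine sum_congr rfl fun p _ => sum_congr rfl fun j _ => ?_
  split_ifs <;> ring

lemma gen_add (F G : Alloc n → ℝ) (s : Alloc n) :
    gen (fun s => F s + G s) s = gen F s + gen G s := by
  simp only [gen, ← sum_add_distrib]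
  refine sum_congr rfl fun p _ => sum_congr rfl fun j _ => ?_
  split_ifs <;> ring

lemma gen_sub_const (F : Alloc n → ℝ) (b : ℝ) (s : Alloc n) :
    gen (fun s => F s - b) s = gen F s := by
  simp only [gen, sub_sub_sub_cancel_right]

lemma gen_const_mul (b : ℝ) (F : Alloc n → ℝ) (s : Alloc n) :
    gen (fun s => b * F s) s = b * gen F s := by
  simp only [gen, mul_sum]
  refine sum_congr rfl fun p _ => sum_congr rfl fun j _ => ?_
  split_ifs <;> ring

lemma gen_comp (F : Alloc n → ℝ) (π : Equiv.Perm (Fin n)) (s : Alloc n) :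
    gen F (s ∘ π) = gen (fun s => F (s ∘ π)) s := by
  refine Fintype.sum_equiv π _ _ fun p => Fintype.sum_equiv π _ _ fun j => ?_
  beta_reduce
  rw [pay_comp]
  rfl

/-- The comparison of generators at a contact point. -/
lemma gen_le_gen {F G : Alloc n → ℝ} {s : Alloc n}
    (h : ∀ s' : Alloc n, ∑ k, s' k = ∑ k, s k → F s' ≤ G s') (hs : F s = G s) :
    gen F s ≤ gen G s := by
  refine sum_le_sum fun p _ => sum_le_sum fun j _ => ?_
  split_ifs with hp
  · have := h _ (sum_pay hp j)
    linarith
  · rfl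

/-- The transition operator of the allocation when everybody volunteers. -/
noncomputable def step (c : ℝ) (F : Alloc n → ℝ) (s : Alloc n) : ℝ := F s + c / n * gen F s

/-- There are at most n(n - 1) proper moves, each of probability c/n, so `step` is an average. -/
lemma step_le {c b : ℝ} (hc : 0 ≤ c) (hc' : (n - 1 : ℝ) * c ≤ 1) (hn : 0 < n)
    {F : Alloc n → ℝ} (hF : ∀ s, F s ≤ b) (s : Alloc n) : step c F s ≤ b := by
  have hn' : (0 : ℝ) < n := by exact_mod_cast hn
  have hd : 0 ≤ b - F s := sub_nonneg.2 (hF s)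
  have h1 : gen F s ≤ n * ((n - 1) * (b - F s)) := by
    have : ∀ p : Fin n, (∑ j, if 0 < s p then F (pay s p j) - F s else 0) ≤
        (n - 1) * (b - F s) := by
      intro p
      rw [← add_sum_erase _ _ (mem_univ p)]
      have h0 : (if 0 < s p then F (pay s p p) - F s else 0) = 0 := by
        split_ifs with hp
        · rw [pay_self hp, sub_self]
        · rfl
      rw [h0, zero_add]
      refine (sum_le_card_nsmul _ _ (b - F s) fun j _ => ?_).trans ?_
      · split_ifs
        · linarith [hF (pay s p j)]
        · exact hd
      · rw [card_erase_of_mem (mem_univ p), card_univ, Fintype.card_fin, nsmul_eq_mul,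
          Nat.cast_sub hn, Nat.cast_one]
    refine (sum_le_card_nsmul _ _ _ fun p _ => this p).trans ?_
    rw [card_univ, Fintype.card_fin, nsmul_eq_mul]
  calc step c F s ≤ F s + c / n * (n * ((n - 1) * (b - F s))) := by
        unfold step
        gcongr
    _ = F s + ((n - 1) * c) * (b - F s) := by field_simp
    _ ≤ F s + 1 * (b - F s) := by gcongr
    _ = b := by ring

lemma abs_step_le {c b : ℝ} (hc : 0 ≤ c) (hc' : (n - 1 : ℝ) * c ≤ 1) (hn : 0 < n)
    {F : Alloc n → ℝ} (hF : ∀ s, |F s| ≤ b) (s : Alloc n) : |step c F s| ≤ b := by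
  rw [abs_le']
  refine ⟨step_le hc hc' hn (fun s => (abs_le'.1 (hF s)).1) s, ?_⟩
  have := step_le hc hc' hn (fun s => (abs_le'.1 (hF s)).2) s
  rw [step, gen_neg] at this
  rw [step]
  linarith

lemma abs_iterate_step_le {c b : ℝ} (hc : 0 ≤ c) (hc' : (n - 1 : ℝ) * c ≤ 1) (hn : 0 < n)
    {u : Alloc n → ℝ} (hu : ∀ s, |u s| ≤ b) (t : ℕ) (s : Alloc n) :
    |(step c)^[t] u s| ≤ b := by
  induction t generalizing s with
  | zero => exact hu s
  | succ t ih =>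
    rw [Function.iterate_succ_apply']
    exact abs_step_le hc hc' hn ih s

/-- The discounted value of the chain with rewards `u`. -/
noncomputable def value (c ρ : ℝ) (u : Alloc n → ℝ) (s : Alloc n) : ℝ :=
  ∑' t : ℕ, ρ ^ t * (step c)^[t] u s

section

variable {c b ρ : ℝ} {u : Alloc n → ℝ}

lemma hasSum_value (hc : 0 ≤ c) (hc' : (n - 1 : ℝ) * c ≤ 1) (hn : 0 < n) (h₀ : 0 ≤ ρ)
    (h₁ : ρ < 1) (hu : ∀ s, |u s| ≤ b) (s : Alloc n) :
    HasSum (fun t : ℕ => ρ ^ t * (step c)^[t] u s) (value c ρ u s) := by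
  refine Summable.hasSum (Summable.of_norm_bounded
    ((summable_geometric_of_lt_one h₀ h₁).mul_right b) fun t => ?_)
  rw [norm_mul, Real.norm_eq_abs, Real.norm_eq_abs, abs_of_nonneg (pow_nonneg h₀ t)]
  gcongr
  exact abs_iterate_step_le hc hc' hn hu t s

lemma abs_value_le (hc : 0 ≤ c) (hc' : (n - 1 : ℝ) * c ≤ 1) (hn : 0 < n) (h₀ : 0 ≤ ρ)
    (h₁ : ρ < 1) (hu : ∀ s, |u s| ≤ b) (s : Alloc n) : |value c ρ u s| ≤ (1 - ρ)⁻¹ * b := by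
  rw [value, ← Real.norm_eq_abs]
  refine tsum_of_norm_bounded ((hasSum_geometric_of_lt_one h₀ h₁).mul_right b) fun t => ?_
  rw [norm_mul, Real.norm_eq_abs, Real.norm_eq_abs, abs_of_nonneg (pow_nonneg h₀ t)]
  gcongr
  exact abs_iterate_step_le hc hc' hn hu t s

lemma value_eq (hc : 0 ≤ c) (hc' : (n - 1 : ℝ) * c ≤ 1) (hn : 0 < n) (h₀ : 0 ≤ ρ)
    (h₁ : ρ < 1) (hu : ∀ s, |u s| ≤ b) (s : Alloc n) :
    value c ρ u s = u s + ρ * step c (value c ρ u) s := by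
  have H := hasSum_value hc hc' hn h₀ h₁ hu
  have hs := (H s).summable
  rw [value, hs.tsum_eq_zero_add]
  congr 1
  · simp
  · refine HasSum.tsum_eq ?_
    have hg : HasSum (fun t : ℕ => ∑ p, ∑ j, if 0 < s p then
        ρ ^ t * (step c)^[t] u (pay s p j) - ρ ^ t * (step c)^[t] u s else 0)
        (gen (value c ρ u) s) := by
      refine hasSum_sum fun p _ => hasSum_sum fun j _ => ?_
      split_ifs
      · exact (H _).sub (H s)
      · exact hasSum_zero
    refine (((H s).add (hg.mul_left (c / n))).mul_left ρ).congr_fun ?_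
    intro t
    rw [Function.iterate_succ_apply']
    simp only [step, gen]
    rw [show (∑ p, ∑ j, if 0 < s p then
        ρ ^ t * (step c)^[t] u (pay s p j) - ρ ^ t * (step c)^[t] u s else 0) =
        ρ ^ t * gen ((step c)^[t] u) s by
      rw [← gen_const_mul]; rfl, gen]
    ring

lemma value_comp {π : Equiv.Perm (Fin n)} (hu : ∀ s, u (s ∘ π) = u s) (s : Alloc n) :
    value c ρ u (s ∘ π) = value c ρ u s := by
  have h : ∀ (t : ℕ) s, (step c)^[t] u (s ∘ π) = (step c)^[t] u s := by
    intro t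
    induction t with
    | zero => exact hu
    | succ t ih =>
      intro s
      rw [Function.iterate_succ_apply', step, step, gen_comp, ih]
      simp only [ih]
  simp only [value, h]

end

/-! ### The number of funded agents and its drift -/

lemma funded_comp {i : Fin n} {π : Equiv.Perm (Fin n)} (hπ : π i = i) (s : Alloc n) :
    funded i (s ∘ π) = funded i s := by
  refine card_equiv π fun k => ?_
  simp only [mem_filter, mem_univ, true_and, Function.comp_apply]
  rw [ne_eq, ne_eq, ← π.injective.eq_iff, hπ]

lemma reward_comp {i : Fin n} {π : Equiv.Perm (Fin n)} (hπ : π i = i) (α c : ℝ) (s : Alloc n) :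
    reward α c i (s ∘ π) = reward α c i s := by
  simp only [reward, funded_comp hπ, Function.comp_apply, hπ]

lemma funded_le_card (i : Fin n) (s : Alloc n) : funded i s ≤ n :=
  (card_le_univ _).trans (Fintype.card_fin n).le

lemma exists_abs_reward_le (α c : ℝ) (i : Fin n) : ∃ b, ∀ s, |reward α c i s| ≤ b := by
  refine ⟨|c / n| * (n + |α| * n), fun s => ?_⟩
  have h : (funded i s : ℝ) ≤ n := by exact_mod_cast funded_le_card i s
  have hn : (1 : ℝ) ≤ n := by exact_mod_cast Fin.pos i
  rw [reward, abs_mul]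
  refine mul_le_mul_of_nonneg_left ((abs_sub _ _).trans (add_le_add ?_ ?_)) (abs_nonneg _)
  · split_ifs
    · rw [abs_of_nonneg] <;> linarith
    · simp
  · rw [abs_mul, Nat.abs_cast]
    gcongr

lemma funded_eq_sum (i : Fin n) (s : Alloc n) :
    funded i s = ∑ k, if k ≠ i ∧ 0 < s k then 1 else 0 := by
  rw [funded, card_filter]

lemma card_pos_le (s : Alloc n) : #{p | 0 < s p} ≤ ∑ k, s k := by
  rw [card_filter]
  exact sum_le_sum fun k _ => by split_ifs <;> omega

lemma funded_le (i : Fin n) (s : Alloc n) : funded i s ≤ ∑ k, s k :=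
  (card_le_card fun k => by simp +contextual).trans (card_pos_le s)

lemma funded_pay (i : Fin n) {s : Alloc n} {p j : Fin n} (hp : 0 < s p) (h : j ≠ p) :
    (funded i (pay s p j) : ℝ) = funded i s - (if p ≠ i ∧ s p = 1 then 1 else 0) +
      (if j ≠ i ∧ s j = 0 then 1 else 0) := by
  have key : ∀ k, (if k ≠ i ∧ 0 < pay s p j k then (1 : ℝ) else 0) =
      (if k ≠ i ∧ 0 < s k then 1 else 0) -
        (if k = p then (if p ≠ i ∧ s p = 1 then 1 else 0) else 0) +
        (if k = j then (if j ≠ i ∧ s j = 0 then 1 else 0) else 0) := by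
    intro k
    by_cases hkp : k = p
    · subst hkp
      rw [pay_apply_requester h, if_pos rfl, if_neg h.symm, add_zero]
      by_cases hk : k = i
      · simp [hk]
      · by_cases h1 : s k = 1
        · simp [hk, h1]
        · have : 0 < s k - 1 := by omega
          simp [hk, h1, hp]
          omega
    · by_cases hkj : k = j
      · subst hkj
        rw [pay_apply_server h, if_neg hkp, if_pos rfl]
        by_cases hk : k = i
        · simp [hk]
        · by_cases h1 : s k = 0
          · simp [hk, h1]
          · simp [hk, h1, Nat.pos_of_ne_zero h1]
      · rw [pay_apply_of_ne hkp hkj]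
        simp [hkp, hkj]
  simp only [funded_eq_sum, Nat.cast_sum, Nat.cast_ite, Nat.cast_one, Nat.cast_zero]
  rw [sum_congr rfl fun k _ => key k, sum_add_distrib, sum_sub_distrib]
  simp

/-- Among the agents other than `i`, a payment gains a funded one if the payee was broke and loses
one if the payer spends its only dollar. -/
lemma gen_funded (i : Fin n) (s : Alloc n) :
    gen (fun s => (funded i s : ℝ)) s =
      #{p | 0 < s p} * ((n : ℝ) - 1 - funded i s) - (n - 1) * #{p | p ≠ i ∧ s p = 1} := by
  have hn : 0 < n := Fin.pos i
  have hY : (∑ j, if j ≠ i ∧ s j = 0 then (1 : ℝ) else 0) = n - 1 - funded i s := by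
    rw [funded_eq_sum]
    push_cast
    rw [eq_sub_iff_add_eq, ← sum_add_distrib, ← add_sum_erase _ _ (mem_univ i),
      sum_congr rfl (g := fun _ => (1 : ℝ))]
    · simp [Nat.cast_sub hn]
    · intro k hk
      have := (mem_erase.1 hk).1
      by_cases h0 : s k = 0
      · simp [this, h0]
      · simp [this, h0, Nat.pos_of_ne_zero h0]
  have key : ∀ p, (∑ j, if 0 < s p then (funded i (pay s p j) : ℝ) - funded i s else 0) =
      (if 0 < s p then 1 else 0) * ((n : ℝ) - 1 - funded i s) -
        (n - 1) * (if p ≠ i ∧ s p = 1 then 1 else 0) := by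
    intro p
    by_cases hp : 0 < s p
    · simp only [hp, if_true, one_mul]
      rw [← hY, ← add_sum_erase _ _ (mem_univ p), pay_self hp, sub_self, zero_add,
        ← add_sum_erase _ _ (mem_univ p), if_neg (by omega), zero_add]
      rw [sum_congr rfl (g := fun j => (if j ≠ i ∧ s j = 0 then (1 : ℝ) else 0) -
        (if p ≠ i ∧ s p = 1 then 1 else 0)), sum_sub_distrib, sum_const,
        card_erase_of_mem (mem_univ p), card_univ, Fintype.card_fin, nsmul_eq_mul,
        Nat.cast_sub hn, Nat.cast_one]
      intro j hj
      rw [funded_pay i hp (mem_erase.1 hj).1]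
      ring
    · have : s p ≠ 1 := by omega
      simp [hp, this]
  rw [gen, sum_congr rfl fun p _ => key p, sum_sub_distrib, ← sum_mul, ← mul_sum, sum_boole,
    sum_boole]

lemma le_gen_funded {i : Fin n} {s : Alloc n} {M : ℕ} (hs : ∑ k, s k = M) (b : ℕ)
    (hb : #{p | p ≠ i ∧ s p = 1} + b ≤ #{p | 0 < s p}) :
    (b : ℝ) * (n - 1) - M ^ 2 ≤ gen (fun s => (funded i s : ℝ)) s := by
  rw [gen_funded]
  have hn : (1 : ℝ) ≤ n := by exact_mod_cast Fin.pos i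
  have h1 : (#{p | 0 < s p} : ℝ) ≤ M := by exact_mod_cast hs ▸ card_pos_le s
  have h2 : (funded i s : ℝ) ≤ M := by exact_mod_cast hs ▸ funded_le i s
  have h3 : (#{p | p ≠ i ∧ s p = 1} : ℝ) + b ≤ #{p | 0 < s p} := by exact_mod_cast hb
  have h4 : (#{p | 0 < s p} : ℝ) * funded i s ≤ M * M := by gcongr
  have h5 := mul_le_mul_of_nonneg_right h3 (sub_nonneg.2 hn)
  nlinarith

/-- If a dollar is misplaced, some payer is `i` or has a dollar to spare. Its payments cost no
funded agent, and most of its n - 1 possible payees are broke. -/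
lemma le_gen_funded_of_ne {i : Fin n} {s : Alloc n} {M : ℕ} (hs : ∑ k, s k = M)
    (h : funded i s ≠ M) : (n : ℝ) - 1 - M ^ 2 ≤ gen (fun s => (funded i s : ℝ)) s := by
  have := le_gen_funded (i := i) hs 1 ?_
  · simpa using this
  · rw [Nat.add_one_le_iff]
    refine card_lt_card (Finset.ssubset_iff_subset_ne.2 ⟨fun k => by simp +contextual, fun he => h ?_⟩)
    rw [funded_eq_sum, ← hs]
    refine sum_congr rfl fun k _ => ?_
    have hk := Finset.ext_iff.1 he k
    simp only [mem_filter, mem_univ, true_and] at hk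
    by_cases h0 : 0 < s k
    · rw [if_pos ⟨(hk.2 h0).1, h0⟩, (hk.2 h0).2]
    · rw [if_neg (by tauto)]
      omega

lemma neg_sq_le_gen_funded (i : Fin n) {s : Alloc n} {M : ℕ} (hs : ∑ k, s k = M) :
    -(M : ℝ) ^ 2 ≤ gen (fun s => (funded i s : ℝ)) s := by
  have := le_gen_funded (i := i) hs 0 ((add_zero _).trans_le
    (card_le_card fun k => by simp +contextual))
  simpa using this

lemma eq_ite_of_funded_eq {i : Fin n} {s : Alloc n} (h : funded i s = ∑ k, s k) (k : Fin n) :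
    s k = if k ≠ i ∧ 0 < s k then 1 else 0 := by
  rw [funded_eq_sum] at h
  exact ((sum_eq_sum_iff_of_le fun k _ => by split_ifs <;> omega).1 h k (mem_univ k)).symm

/-- Both allocations are indicators of M-element sets of agents avoiding `i`. -/
lemma exists_perm_comp_eq {i : Fin n} {s s' : Alloc n} {M : ℕ} (hs : ∑ k, s k = M)
    (hs' : ∑ k, s' k = M) (h : funded i s = M) (h' : funded i s' = M) :
    ∃ π : Equiv.Perm (Fin n), π i = i ∧ s ∘ π = s' := by
  let e : {k // k ≠ i ∧ 0 < s' k} ≃ {k // k ≠ i ∧ 0 < s k} :=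
    Fintype.equivOfCardEq (by rw [Fintype.card_subtype, Fintype.card_subtype]; exact h'.trans h.symm)
  let π := e.extendSubtype
  have h1 : ∀ k, (k ≠ i ∧ 0 < s' k) → (π k ≠ i ∧ 0 < s (π k)) := fun k hk =>
    e.extendSubtype_mem k hk
  have h2 : ∀ k, ¬(k ≠ i ∧ 0 < s' k) → ¬(π k ≠ i ∧ 0 < s (π k)) := fun k hk =>
    e.extendSubtype_not_mem k hk
  -- The extension `π` may move `i`; the swap brings it back, and it touches only agents outside the
  -- funded set.
  refine ⟨π.trans (Equiv.swap (π i) i), by simp, ?_⟩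
  funext k
  rw [eq_ite_of_funded_eq (h'.trans hs'.symm) k]
  simp only [Function.comp_apply, Equiv.trans_apply]
  rw [eq_ite_of_funded_eq (h.trans hs.symm)]
  by_cases hk : k ≠ i ∧ 0 < s' k
  · rw [if_pos hk, Equiv.swap_apply_of_ne_of_ne (by simpa using hk.1) (h1 k hk).1,
      if_pos (h1 k hk)]
  · rw [if_neg hk, if_neg]
    by_cases hk1 : π k = π i
    · simp [hk1]
    · by_cases hk2 : π k = i
      · rw [hk2, Equiv.swap_apply_right]
        exact h2 i (by simp)
      · rw [Equiv.swap_apply_of_ne_of_ne hk1 hk2]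
        exact h2 k hk

lemma exists_funded_eq (i : Fin n) {M : ℕ} (hM : M < n) :
    ∃ s : Alloc n, ∑ k, s k = M ∧ funded i s = M := by
  obtain ⟨S, hS, hc⟩ := exists_subset_card_eq (s := univ.erase i) (n := M)
    (by rw [card_erase_of_mem (mem_univ i), card_univ, Fintype.card_fin]; omega)
  refine ⟨fun k => if k ∈ S then 1 else 0, by simp [hc], ?_⟩
  rw [← hc, funded]
  congr 1
  ext k
  simp only [mem_filter, mem_univ, true_and]
  constructor
  · rintro ⟨-, h⟩
    by_contra hk
    simp [hk] at h
  · intro h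
    simp [h, (mem_erase.1 (hS h)).1]

/-! ### Oscillation bound by a barrier argument -/

section Oscillation

variable {i : Fin n} {M : ℕ} {ρ κ R : ℝ} {e r : Alloc n → ℝ}

lemma gen_misplaced (K : ℝ) (s : Alloc n) :
    gen (fun s => K * ((M : ℝ) - funded i s)) s = -(K * gen (fun s => (funded i s : ℝ)) s) := by
  rw [gen_const_mul, ← mul_neg, ← gen_neg]
  congr 1
  simp only [gen]
  refine sum_congr rfl fun p _ => sum_congr rfl fun j _ => ?_
  split_ifs <;> ring

/-- The barrier K(M - `funded`) dominates |e - e x| and is touched at `s` and at `x`, which bounds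
the generator of `e` at both points. Subtracting the two Poisson equations leaves (1 - ρ)(e s - e x)
≥ 0, which can be dropped: hence no dependence on how close ρ is to 1. -/
lemma contact_bound (hρ : ρ ≤ 1) (hκ : 0 ≤ κ)
    (he : ∀ s, ∑ k, s k = M → (1 - ρ) * e s = r s + κ * gen e s)
    (hr : ∀ s, ∑ k, s k = M → |r s| ≤ R) {x : Alloc n} (hx : ∑ k, x k = M)
    (hxM : funded i x = M) {K : ℝ} (hK : 0 ≤ K)
    (hw : ∀ s, ∑ k, s k = M → |e s - e x| ≤ K * (M - funded i s))
    {s : Alloc n} (hs : ∑ k, s k = M) (hsM : funded i s ≠ M)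
    (hc : e s - e x = K * (M - funded i s)) :
    κ * K * (n - 1 - 2 * M ^ 2) ≤ 2 * R := by
  have h1 : gen e s ≤ -(K * gen (fun s => (funded i s : ℝ)) s) := by
    rw [← gen_sub_const e (e x), ← gen_misplaced (M := M)]
    exact gen_le_gen (fun s' h' => (abs_le'.1 (hw s' (h'.trans hs))).1) hc
  have h2 : -gen e x ≤ -(K * gen (fun s => (funded i s : ℝ)) x) := by
    rw [← gen_sub_const e (e x), ← gen_neg, ← gen_misplaced (M := M)]
    refine gen_le_gen (fun s' h' => (abs_le'.1 (hw s' (h'.trans hx))).2) ?_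
    rw [hxM]
    simp
  have h3 := mul_le_mul_of_nonneg_left (le_gen_funded_of_ne hs hsM) hK
  have h4 := mul_le_mul_of_nonneg_left (neg_sq_le_gen_funded i hx) hK
  have h5 : gen e s - gen e x ≤ -(K * (n - 1 - 2 * M ^ 2)) := by linarith
  have h6 := mul_le_mul_of_nonneg_left h5 hκ
  have h7 : 0 ≤ (1 - ρ) * (e s - e x) :=
    mul_nonneg (sub_nonneg.2 hρ) (hc ▸ (abs_nonneg _).trans (hw s hs))
  have h8 := (abs_le.1 (hr s hs)).2
  have h9 := (abs_le.1 (hr x hx)).1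
  have h10 := he s hs
  have h11 := he x hx
  nlinarith

/-- The oscillation of a solution of the discounted Poisson equation, uniformly in the discount:
the number of misplaced dollars is a Lyapunov function. -/
lemma abs_sub_le_of_poisson (hρ : ρ ≤ 1) (hκ : 0 < κ) (hR : 0 ≤ R) (hMn : M < n)
    (hn : 0 < (n - 1 - 2 * M ^ 2 : ℝ))
    (he : ∀ s, ∑ k, s k = M → (1 - ρ) * e s = r s + κ * gen e s)
    (hr : ∀ s, ∑ k, s k = M → |r s| ≤ R)
    (hinv : ∀ π : Equiv.Perm (Fin n), π i = i → ∀ s, e (s ∘ π) = e s)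
    {s s' : Alloc n} (hs : ∑ k, s k = M) (hs' : ∑ k, s' k = M) :
    |e s - e s'| ≤ 4 * M * R / (κ * (n - 1 - 2 * M ^ 2)) := by
  obtain ⟨x, hx, hxM⟩ := exists_funded_eq i hMn
  have hw0 : ∀ s, ∑ k, s k = M → funded i s = M → e s = e x := by
    intro s hs hsM
    obtain ⟨π, hπ, rfl⟩ := exists_perm_comp_eq hx hs hxM hsM
    exact hinv π hπ x
  have hN : ∀ s : Alloc n, ∑ k, s k = M → (0 : ℝ) ≤ M - funded i s := by
    intro s hs
    have : (funded i s : ℝ) ≤ M := by exact_mod_cast hs ▸ funded_le i s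
    linarith
  have hN' : ∀ s : Alloc n, ∑ k, s k = M → funded i s ≠ M → (0 : ℝ) < M - funded i s := by
    intro s hs h
    exact lt_of_le_of_ne (hN s hs) fun h0 => h (by exact_mod_cast (sub_eq_zero.1 h0.symm).symm)
  -- The maximal quotient is the slope K of the least barrier. Where no dollar is misplaced the
  -- quotient is 0/0 = 0, which does no harm since `e` equals `e x` there.
  obtain ⟨z, hz, hmax⟩ := exists_max_image (piAntidiag (univ : Finset (Fin n)) M)
    (fun s => |e s - e x| / (M - funded i s)) ⟨x, by simp [hx]⟩
  simp only [mem_piAntidiag, mem_univ, implies_true, and_true] at hz hmax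
  set K := |e z - e x| / (M - funded i z) with hK
  have hK0 : 0 ≤ K := div_nonneg (abs_nonneg _) (hN z hz)
  have hw : ∀ s, ∑ k, s k = M → |e s - e x| ≤ K * (M - funded i s) := by
    intro s hs
    by_cases h : funded i s = M
    · rw [hw0 s hs h, h]
      simp
    · rw [← div_le_iff₀ (hN' s hs h)]
      exact hmax s hs
  have hKb : κ * K * (n - 1 - 2 * M ^ 2) ≤ 2 * R := by
    by_cases h : funded i z = M
    · have : K = 0 := by rw [hK, h]; simp
      rw [this]
      linarith
    · have hc : |e z - e x| = K * (M - funded i z) := by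
        rw [hK, div_mul_cancel₀ _ (hN' z hz h).ne']
      rcases abs_choice (e z - e x) with h' | h'
      · exact contact_bound hρ hκ.le he hr hx hxM hK0 hw hz h (h' ▸ hc)
      · refine contact_bound (e := fun s => -e s) (r := fun s => -r s) hρ hκ.le ?_ ?_ hx hxM
          hK0 ?_ hz h ?_
        · intro s hs
          rw [gen_neg]
          linarith [he s hs]
        · intro s hs
          rw [abs_neg]
          exact hr s hs
        · intro s hs
          rw [← abs_neg]
          convert hw s hs using 2
          ring
        · rw [← hc, h']
          ring
  have hKM : ∀ s, ∑ k, s k = M → |e s - e x| ≤ K * M := fun s hs =>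
    (hw s hs).trans (mul_le_mul_of_nonneg_left (by simp) hK0)
  have h1 : |e s - e s'| ≤ 2 * (K * M) := by
    have := abs_sub_le (e s) (e x) (e s')
    rw [abs_sub_comm (e x)] at this
    linarith [hKM s hs, hKM s' hs']
  refine h1.trans ?_
  rw [le_div_iff₀ (mul_pos hκ hn)]
  have := mul_le_mul_of_nonneg_left hKb (show (0 : ℝ) ≤ 2 * M by positivity)
  linarith

end Oscillation

/-! ### The marginal value of a dollar -/

lemma gen_apply_self (f : ℕ → ℝ) (i : Fin n) (s : Alloc n) :
    gen (fun s => f (s i)) s =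
      (if 0 < s i then (n - 1 : ℝ) * (f (s i - 1) - f (s i)) else 0) +
        funded i s * (f (s i + 1) - f (s i)) := by
  have key : ∀ p, (∑ j, if 0 < s p then f (pay s p j i) - f (s i) else 0) =
      (if p = i then (if 0 < s i then (n - 1 : ℝ) * (f (s i - 1) - f (s i)) else 0) else 0) +
        (if p ≠ i ∧ 0 < s p then 1 else 0) * (f (s i + 1) - f (s i)) := by
    intro p
    by_cases hp : 0 < s p
    · simp only [hp, if_true, and_true]
      by_cases hi : p = i
      · subst hi
        rw [← add_sum_erase _ _ (mem_univ p), pay_self hp,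
          sum_congr rfl (g := fun _ => f (s p - 1) - f (s p)), sum_const,
          card_erase_of_mem (mem_univ p), card_univ, Fintype.card_fin, nsmul_eq_mul,
          Nat.cast_sub (Fin.pos p)]
        · simp [hp]
        · intro j hj
          rw [pay_apply_requester (mem_erase.1 hj).1]
      · rw [sum_eq_single i, pay_apply_server (Ne.symm hi)]
        · simp [hi]
        · intro j _ hj
          rw [pay_apply_of_ne (Ne.symm hi) (Ne.symm hj), sub_self]
        · simp
    · by_cases hi : p = i
      · subst hi; simp [hp]
      · simp [hp, hi]
  rw [gen, sum_congr rfl fun p _ => key p, sum_add_distrib, ← sum_mul, funded_eq_sum,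
    sum_ite_eq' univ i, if_pos (mem_univ i)]
  push_cast
  rfl

/-- The approximate value of `a` dollars. -/
noncomputable def dollarValue (ρ θ : ℝ) (a : ℕ) : ℝ := θ * ∑ b ∈ range a, (ρ * θ) ^ b

lemma dollarValue_zero (ρ θ : ℝ) : dollarValue ρ θ 0 = 0 := by simp [dollarValue]

lemma dollarValue_succ (ρ θ : ℝ) (a : ℕ) :
    dollarValue ρ θ (a + 1) = θ * (1 + ρ * dollarValue ρ θ a) := by
  rw [dollarValue, dollarValue, geom_sum_succ]
  ring

lemma dollarValue_succ_sub (ρ θ : ℝ) (a : ℕ) :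
    dollarValue ρ θ (a + 1) - dollarValue ρ θ a = θ * (ρ * θ) ^ a := by
  rw [dollarValue, dollarValue, sum_range_succ]
  ring

/-- Having a dollar is better than leaving it to another agent, by almost `1`. -/
lemma le_value_sub {α c ρ θ b : ℝ} {i : Fin n} {M : ℕ} (hα₀ : 0 ≤ α) (hα₁ : α ≤ 1)
    (hc : 0 < c) (hρ₀ : 0 < ρ) (hρ₁ : ρ ≤ 1) (hθ₀ : 0 ≤ θ) (hθ₁ : θ ≤ 1)
    (hθ : θ * (n * (1 - ρ) + ρ * ((n - 1) * c)) = (n - 1) * c) (hMn : M < n)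
    (hn : 0 < (n - 1 - 2 * M ^ 2 : ℝ)) {V : Alloc n → ℝ}
    (hV : ∀ s, V s = reward α c i s + ρ * step c V s)
    (hinv : ∀ π : Equiv.Perm (Fin n), π i = i → ∀ s, V (s ∘ π) = V s)
    {s s' : Alloc n} (hs : ∑ k, s k = M) (hs' : ∑ k, s' k = M) (hi : s i = s' i + 1)
    (hb : b ≤ ρ * (ρ * θ) ^ M - 4 * M ^ 2 / (n - 1 - 2 * M ^ 2)) :
    ρ * V s' ≤ -b + ρ * V s := by
  have hn0 : (0 : ℝ) < n := by exact_mod_cast Fin.pos i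
  have hκ : 0 < ρ * c / n := by positivity
  have hρθ₀ : 0 ≤ ρ * θ := by positivity
  have hρθ₁ : ρ * θ ≤ 1 := mul_le_one₀ hρ₁ hθ₀ hθ₁
  -- The source `r` is what `dollarValue` ignores: each of the funded others may pay `i`, who gains
  -- the discounted marginal dollar and loses α.
  have hosc := abs_sub_le_of_poisson (i := i) (M := M) (ρ := ρ) (κ := ρ * c / n)
    (R := c / n * M) (e := fun s => V s - dollarValue ρ θ (s i))
    (r := fun s => c / n * (funded i s * (ρ * (θ * (ρ * θ) ^ s i) - α))) hρ₁ hκ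
    (by positivity) hMn hn ?_ ?_ ?_ hs hs'
  · have hd := dollarValue_succ_sub ρ θ (s' i)
    have hval : 4 * M * (c / n * M) / (ρ * c / n * (n - 1 - 2 * M ^ 2)) =
        4 * M ^ 2 / (n - 1 - 2 * M ^ 2) / ρ := by
      have := hn.ne'
      field_simp
    rw [hval] at hosc
    have h1 := (abs_le.1 hosc).1
    rw [hi] at h1
    have hle : s' i + 1 ≤ M := by
      rw [← hi, ← hs]
      exact single_le_sum (f := s) (fun _ _ => Nat.zero_le _) (mem_univ i)
    have h2 : (ρ * θ) ^ M ≤ θ * (ρ * θ) ^ s' i := by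
      calc (ρ * θ) ^ M ≤ (ρ * θ) ^ (s' i + 1) := pow_le_pow_of_le_one hρθ₀ hρθ₁ hle
        _ = ρ * (θ * (ρ * θ) ^ s' i) := by ring
        _ ≤ θ * (ρ * θ) ^ s' i := mul_le_of_le_one_left (by positivity) hρ₁
    have h3 : (ρ * θ) ^ M - 4 * M ^ 2 / (n - 1 - 2 * M ^ 2) / ρ ≤ V s - V s' := by linarith
    have h4 := mul_le_mul_of_nonneg_left h3 hρ₀.le
    rw [mul_sub, mul_div_cancel₀ _ hρ₀.ne'] at h4
    linarith
  · intro s _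
    have h := hV s
    have hg : gen V s = gen (fun s => V s - dollarValue ρ θ (s i)) s +
        gen (fun s => dollarValue ρ θ (s i)) s := by
      rw [← gen_add]
      simp
    rw [step, reward, hg, gen_apply_self, dollarValue_succ_sub] at h
    set g := gen (fun s => V s - dollarValue ρ θ (s i)) s
    set f := dollarValue ρ θ with hf
    -- By the choice of θ, `dollarValue` solves the Bellman equation of an agent who only spends.
    have hz : c / n * (if 0 < s i then (n - 1 : ℝ) else 0) - (1 - ρ) * f (s i) +
        ρ * (c / n * (if 0 < s i then (n - 1 : ℝ) * (f (s i - 1) - f (s i)) else 0)) = 0 := by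
      rcases hsi : s i with _ | a
      · simp [hf, dollarValue_zero]
      · simp only [Nat.succ_pos, if_true, Nat.add_sub_cancel, hf]
        rw [dollarValue_succ]
        field_simp
        linear_combination (-(1 + ρ * dollarValue ρ θ a)) * hθ
    linear_combination h + hz
  · intro s hs
    have h1 : (funded i s : ℝ) ≤ M := by exact_mod_cast hs ▸ funded_le i s
    have h2 : ρ * (θ * (ρ * θ) ^ s i) ≤ 1 :=
      mul_le_one₀ hρ₁ (by positivity) (mul_le_one₀ hθ₁ (by positivity)
        (pow_le_one₀ hρθ₀ hρθ₁))
    have h3 : 0 ≤ ρ * (θ * (ρ * θ) ^ s i) := by positivity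
    have h4 : |ρ * (θ * (ρ * θ) ^ s i) - α| ≤ 1 := abs_le.2 ⟨by linarith, by linarith⟩
    rw [abs_mul, abs_mul, Nat.abs_cast, abs_of_nonneg (by positivity : 0 ≤ c / n)]
    refine mul_le_mul_of_nonneg_left ?_ (by positivity)
    calc (funded i s : ℝ) * |ρ * (θ * (ρ * θ) ^ s i) - α| ≤ M * 1 := by gcongr
      _ = M := mul_one _
  · intro π hπ s
    simp only [hinv π hπ, Function.comp_apply, hπ]

end Chain

/-! ### From the Bellman equation to expected utilities -/

section Play

open Filter Topology

/-- Discounting the inequalities makes the sum telescope; the remainder ρ^T a_T vanishes because `a`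
is bounded. -/
lemma tsum_le_of_telescoping {ρ B b : ℝ} (h₀ : 0 ≤ ρ) (h₁ : ρ < 1) {u a : ℕ → ℝ}
    (hu : ∀ t, |u t| ≤ B) (ha : ∀ t, |a t| ≤ b) (h : ∀ t, u t + ρ * a (t + 1) ≤ a t) :
    ∑' t, ρ ^ t * u t ≤ a 0 := by
  have hs : Summable fun t => ρ ^ t * u t := by
    refine Summable.of_norm_bounded ((summable_geometric_of_lt_one h₀ h₁).mul_right B) fun t => ?_
    rw [norm_mul, Real.norm_eq_abs, Real.norm_eq_abs, abs_of_nonneg (pow_nonneg h₀ t)]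
    gcongr
    exact hu t
  have hp : ∀ T, ∑ t ∈ range T, ρ ^ t * u t ≤ a 0 - ρ ^ T * a T := by
    intro T
    induction T with
    | zero => simp
    | succ T ih =>
      rw [sum_range_succ, pow_succ]
      have := mul_le_mul_of_nonneg_left (h T) (pow_nonneg h₀ T)
      linarith
  have hl : Tendsto (fun T => a 0 + ρ ^ T * b) atTop (𝓝 (a 0)) := by
    simpa using ((tendsto_pow_atTop_nhds_zero_of_lt_one h₀ h₁).mul_const b).const_add (a 0)
  refine le_of_tendsto_of_tendsto' hs.hasSum.tendsto_sum_nat hl fun T => (hp T).trans ?_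
  have := mul_le_mul_of_nonneg_left (neg_le_of_abs_le (ha T)) (pow_nonneg h₀ T)
  linarith

variable {n : ℕ}

lemma sum_vector_succ {A : Type*} [Fintype A] (t : ℕ) (G : List A → ℝ) :
    ∑ h : List.Vector A (t + 1), G h.toList =
      ∑ h : List.Vector A t, ∑ r, G (r :: h.toList) := by
  rw [← Fintype.sum_prod_type' (f := fun (h : List.Vector A t) r => G (r :: h.toList))]
  symm
  refine Fintype.sum_bijective (fun x : List.Vector A t × A => x.2 ::ᵥ x.1) ⟨?_, ?_⟩ _ _
    fun x => by simp
  · rintro ⟨h, r⟩ ⟨h', r'⟩ he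
    have h1 := congrArg List.Vector.head he
    have h2 := congrArg List.Vector.tail he
    simp at h1 h2
    rw [h1, h2]
  · intro h
    exact ⟨(h.tail, h.head), List.Vector.cons_head_tail h⟩

/-- The expectation of a function of the first `t` rounds. -/
noncomputable def historyMean (β : ℝ) (s₀ : Alloc n) (σ : Fin n → Strategy n) (t : ℕ)
    (G : History n → ℝ) : ℝ :=
  ∑ h : List.Vector (Round n) t, historyProb β s₀ σ h.toList * G h.toList

section

variable {β : ℝ} {s₀ : Alloc n} {σ : Fin n → Strategy n}

lemma historyMean_zero (G : History n → ℝ) : historyMean β s₀ σ 0 G = G [] := by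
  rw [historyMean, Fintype.sum_eq_single List.Vector.nil fun h hh => absurd h.eq_nil hh]
  exact one_mul _

lemma historyMean_succ (t : ℕ) (G : History n → ℝ) :
    historyMean β s₀ σ (t + 1) G =
      historyMean β s₀ σ t fun h => ∑ r, roundProb β s₀ σ h r * G (r :: h) := by
  rw [historyMean, sum_vector_succ t fun h => historyProb β s₀ σ h * G h, historyMean]
  refine sum_congr rfl fun h _ => ?_
  rw [mul_sum]
  refine sum_congr rfl fun r _ => ?_
  rw [historyProb, mul_assoc]

lemma historyProb_nonneg (h₀ : 0 ≤ β) (h₁ : β ≤ 1) (h : History n) :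
    0 ≤ historyProb β s₀ σ h := by
  induction h with
  | nil => exact zero_le_one
  | cons r h ih => exact mul_nonneg ih (roundProb_nonneg h₀ h₁ _ _ _ _)

lemma historyMean_one (hn : 0 < n) (t : ℕ) : historyMean β s₀ σ t (fun _ => 1) = 1 := by
  induction t with
  | zero => rw [historyMean_zero]
  | succ t ih =>
    rw [historyMean_succ]
    simpa only [mul_one, sum_roundProb hn] using ih

/-- Histories that do not conserve money have probability 0, so the comparison is needed only on the
others. -/
lemma historyMean_mono (h₀ : 0 ≤ β) (h₁ : β ≤ 1) (t : ℕ) {G G' : History n → ℝ}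
    (h : ∀ h, ∑ k, money s₀ h k = ∑ k, s₀ k → G h ≤ G' h) :
    historyMean β s₀ σ t G ≤ historyMean β s₀ σ t G' := by
  refine sum_le_sum fun x _ => ?_
  by_cases hx : historyProb β s₀ σ x.toList = 0
  · simp [hx]
  · exact mul_le_mul_of_nonneg_left (h _ (sum_money hx)) (historyProb_nonneg h₀ h₁ _)

lemma historyMean_neg (t : ℕ) (G : History n → ℝ) :
    historyMean β s₀ σ t (fun h => -G h) = -historyMean β s₀ σ t G := by
  simp [historyMean]

lemma abs_historyMean_le (hn : 0 < n) (h₀ : 0 ≤ β) (h₁ : β ≤ 1) (t : ℕ) {G : History n → ℝ}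
    {b : ℝ} (h : ∀ h, |G h| ≤ b) : |historyMean β s₀ σ t G| ≤ b := by
  have hb : historyMean β s₀ σ t (fun _ => b) = b := by
    have := historyMean_one (β := β) (s₀ := s₀) (σ := σ) hn t
    simp only [historyMean, mul_one] at this
    rw [historyMean, ← sum_mul, this, one_mul]
  rw [abs_le', ← historyMean_neg]
  constructor
  · exact (historyMean_mono h₀ h₁ t fun x _ => (abs_le'.1 (h x)).1).trans hb.le
  · exact (historyMean_mono h₀ h₁ t fun x _ => (abs_le'.1 (h x)).2).trans hb.le

lemma expectedRoundUtility_eq (α : ℝ) (i : Fin n) (t : ℕ) :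
    expectedRoundUtility α β s₀ σ i t =
      historyMean β s₀ σ t fun h => ∑ r, roundProb β s₀ σ h r * roundUtility α i r := by
  simp only [expectedRoundUtility, historyMean, mul_sum, mul_assoc]

lemma expectedRoundUtility_add (α ρ : ℝ) (i : Fin n) (t : ℕ) (F : Alloc n → ℝ) :
    expectedRoundUtility α β s₀ σ i t +
        ρ * historyMean β s₀ σ (t + 1) (fun h => F (money s₀ h)) =
      historyMean β s₀ σ t fun h => ∑ r, roundProb β s₀ σ h r *
        (roundUtility α i r + ρ * F (nextAlloc (money s₀ h) r)) := by
  rw [expectedRoundUtility_eq, historyMean_succ, historyMean, historyMean, historyMean, mul_sum,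
    ← sum_add_distrib]
  refine sum_congr rfl fun h _ => ?_
  rw [mul_left_comm, ← mul_add]
  congr 1
  rw [mul_sum, ← sum_add_distrib]
  refine sum_congr rfl fun r _ => ?_
  rw [money]
  ring

lemma abs_roundUtility_le {α : ℝ} (hα₀ : 0 ≤ α) (hα₁ : α ≤ 1) (i : Fin n) (r : Round n) :
    |roundUtility α i r| ≤ 1 := by
  rw [roundUtility, abs_le]
  split_ifs <;> constructor <;> linarith

lemma abs_expectedRoundUtility_le {α : ℝ} (hα₀ : 0 ≤ α) (hα₁ : α ≤ 1) (h₀ : 0 ≤ β)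
    (h₁ : β ≤ 1) (i : Fin n) (t : ℕ) : |expectedRoundUtility α β s₀ σ i t| ≤ 1 := by
  rw [expectedRoundUtility_eq]
  refine abs_historyMean_le (Fin.pos i) h₀ h₁ t fun h => ?_
  refine (abs_sum_le_sum_abs _ _).trans ?_
  rw [← sum_roundProb (Fin.pos i) β s₀ σ h]
  refine sum_le_sum fun r _ => ?_
  rw [abs_mul, abs_of_nonneg (roundProb_nonneg h₀ h₁ s₀ σ h r)]
  exact mul_le_of_le_one_right (roundProb_nonneg h₀ h₁ s₀ σ h r) (abs_roundUtility_le hα₀ hα₁ i r)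

lemma expectedUtility_eq {δ : ℝ} (hδ : 0 ≤ δ) (α : ℝ) (i : Fin n) :
    expectedUtility δ α β s₀ σ i =
      ∑' t : ℕ, (δ ^ (1 / n : ℝ)) ^ t * expectedRoundUtility α β s₀ σ i t := by
  refine tsum_congr fun t => ?_
  rw [← Real.rpow_natCast, ← Real.rpow_mul hδ, one_div_mul_eq_div]

/-- Verification: a bounded supersolution of the Bellman equation bounds the utility. -/
lemma tsum_expectedRoundUtility_le {α ρ b : ℝ} (hα₀ : 0 ≤ α) (hα₁ : α ≤ 1) (h₀ : 0 ≤ β)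
    (h₁ : β ≤ 1) (hρ₀ : 0 ≤ ρ) (hρ₁ : ρ < 1) (i : Fin n) {F : Alloc n → ℝ}
    (hF : ∀ s, |F s| ≤ b)
    (h : ∀ h, ∑ k, money s₀ h k = ∑ k, s₀ k → ∑ r, roundProb β s₀ σ h r *
      (roundUtility α i r + ρ * F (nextAlloc (money s₀ h) r)) ≤ F (money s₀ h)) :
    ∑' t : ℕ, ρ ^ t * expectedRoundUtility α β s₀ σ i t ≤ F s₀ := by
  have := tsum_le_of_telescoping hρ₀ hρ₁ (u := fun t => expectedRoundUtility α β s₀ σ i t)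
    (a := fun t => historyMean β s₀ σ t fun h => F (money s₀ h))
    (abs_expectedRoundUtility_le hα₀ hα₁ h₀ h₁ i)
    (fun t => abs_historyMean_le (Fin.pos i) h₀ h₁ t fun h => hF _) fun t => by
      rw [expectedRoundUtility_add]
      exact historyMean_mono h₀ h₁ t h
  rwa [historyMean_zero] at this

lemma le_tsum_expectedRoundUtility {α ρ b : ℝ} (hα₀ : 0 ≤ α) (hα₁ : α ≤ 1) (h₀ : 0 ≤ β)
    (h₁ : β ≤ 1) (hρ₀ : 0 ≤ ρ) (hρ₁ : ρ < 1) (i : Fin n) {F : Alloc n → ℝ}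
    (hF : ∀ s, |F s| ≤ b)
    (h : ∀ h, ∑ k, money s₀ h k = ∑ k, s₀ k → F (money s₀ h) ≤ ∑ r, roundProb β s₀ σ h r *
      (roundUtility α i r + ρ * F (nextAlloc (money s₀ h) r))) :
    F s₀ ≤ ∑' t : ℕ, ρ ^ t * expectedRoundUtility α β s₀ σ i t := by
  have := tsum_le_of_telescoping hρ₀ hρ₁ (u := fun t => -expectedRoundUtility α β s₀ σ i t)
    (a := fun t => -historyMean β s₀ σ t fun h => F (money s₀ h)) (B := 1) (b := b)
    (fun t => by
      rw [abs_neg]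
      exact abs_expectedRoundUtility_le hα₀ hα₁ h₀ h₁ i t)
    (fun t => by
      rw [abs_neg]
      exact abs_historyMean_le (Fin.pos i) h₀ h₁ t fun h => hF _) fun t => by
      have := historyMean_mono (σ := σ) h₀ h₁ t h
      rw [← expectedRoundUtility_add] at this
      linarith
  simp only [mul_neg, tsum_neg] at this
  rw [historyMean_zero] at this
  exact neg_le_neg_iff.1 this

end

/-! ### The equilibrium and the choice of constants -/

/-- With threshold `M` the total amount of money, nobody gains by deviating, provided that
`α` is below the approximate discounted gain from a dollar. -/
lemma isNashEquilibrium_threshold {δ α β : ℝ} (hα₀ : 0 ≤ α) (hα₁ : α ≤ 1) (hβ₀ : 0 < β)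
    (hβ₁ : β ≤ 1) (hδ₀ : 0 < δ) (hδ₁ : δ < 1) {M : ℕ} (hM : 0 < M) (hMn : M < n)
    (hn : 0 < (n - 1 - 2 * M ^ 2 : ℝ))
    (h : α ≤ δ * (δ * (β / (β - Real.log δ))) ^ M - 4 * M ^ 2 / (n - 1 - 2 * M ^ 2))
    {s₀ : Alloc n} (hs₀ : ∑ k, s₀ k = M) :
    IsNashEquilibrium δ α β s₀ fun i : Fin n => threshold M i := by
  intro i τ
  have hn0 : (0 : ℝ) < n := by exact_mod_cast Fin.pos i
  have : Nontrivial (Fin n) := Fin.nontrivial_iff_two_le.2 (by omega)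
  obtain ⟨j, hj⟩ := exists_ne i
  set c := serviceProb β i j
  set ρ := δ ^ (1 / n : ℝ) with hρ
  have hρ₀ : 0 < ρ := Real.rpow_pos_of_pos hδ₀ _
  have hρ₁ : ρ < 1 := Real.rpow_lt_one hδ₀.le hδ₁ (by positivity)
  have hδρ : δ ≤ ρ := by
    have h1n : (1 : ℝ) ≤ n := by exact_mod_cast Fin.pos i
    conv_lhs => rw [← Real.rpow_one δ]
    exact Real.rpow_le_rpow_of_exponent_ge hδ₀ hδ₁.le ((div_le_one hn0).2 h1n)
  have hm := sum_serviceProb_eq (β := β) hj.symm i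
  have hm₁ : (n - 1 : ℝ) * c ≤ 1 := hm ▸ sum_serviceProb_le_one hβ₀.le hβ₁ i
  have hm₀ : β ≤ (n - 1 : ℝ) * c := hm ▸ le_sum_serviceProb hβ₀.le hβ₁ hj
  have hc : 0 < c := lt_of_le_of_ne (serviceProb_nonneg hβ₀.le hβ₁ i j) fun h0 => by
    rw [← h0, mul_zero] at hm₀
    linarith
  set m := (n - 1 : ℝ) * c with hmdef
  have hm0 : 0 < m := hβ₀.trans_le hm₀
  -- As log ρ = (log δ)/n, this bounds the discounting per n rounds independently of n.
  have hlog : n * (1 - ρ) ≤ -Real.log δ := by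
    have h1 := Real.log_le_sub_one_of_pos hρ₀
    rw [hρ, Real.log_rpow hδ₀, ← hρ] at h1
    have h2 := mul_le_mul_of_nonneg_left h1 hn0.le
    rw [← mul_assoc, mul_one_div_cancel hn0.ne', one_mul] at h2
    linarith
  have hlog₀ : 0 < -Real.log δ := neg_pos.2 (Real.log_neg hδ₀ hδ₁)
  have hden : m ≤ n * (1 - ρ) + ρ * m := by
    have h1n : (1 : ℝ) ≤ n := by exact_mod_cast Fin.pos i
    nlinarith [mul_nonneg (sub_nonneg.2 hρ₁.le) (sub_nonneg.2 (hm₁.trans h1n))]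
  have hden₀ : 0 < n * (1 - ρ) + ρ * m := hm0.trans_le hden
  -- This is the mean of ρ^T, with T the number of rounds before a funded `i` is first served, at
  -- chance m/n per round.
  set θ := m / (n * (1 - ρ) + ρ * m) with hθ
  have hθ₀ : 0 ≤ θ := by positivity
  have hθ₁ : θ ≤ 1 := (div_le_one hden₀).2 hden
  have hθβ : β / (β - Real.log δ) ≤ θ := by
    rw [hθ, div_le_div_iff₀ (by linarith) hden₀]
    have h1 := mul_le_mul_of_nonneg_left hlog hβ₀.le
    have h2 := mul_le_mul_of_nonneg_right hm₀ hlog₀.le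
    have h3 := mul_le_mul_of_nonneg_right hρ₁.le (mul_pos hβ₀ hm0).le
    linarith
  have hα : α ≤ ρ * (ρ * θ) ^ M - 4 * M ^ 2 / (n - 1 - 2 * M ^ 2) := by
    have h0 : 0 ≤ β / (β - Real.log δ) := div_nonneg hβ₀.le (by linarith)
    refine h.trans (sub_le_sub_right ?_ _)
    gcongr
  obtain ⟨b, hb⟩ := exists_abs_reward_le α c i
  set V := value c ρ (reward α c i) with hVdef
  have hV : ∀ s, V s = reward α c i s + ρ * step c V s :=
    value_eq hc.le hm₁ (Fin.pos i) hρ₀.le hρ₁ hb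
  have hVb : ∀ s, |V s| ≤ (1 - ρ)⁻¹ * b :=
    abs_value_le hc.le hm₁ (Fin.pos i) hρ₀.le hρ₁ hb
  have hVinv : ∀ π : Equiv.Perm (Fin n), π i = i → ∀ s, V (s ∘ π) = V s := fun π hπ =>
    value_comp (reward_comp hπ α c)
  have hcoop : ∀ s, cooperativeValue α β ρ i V s = V s := fun s => by
    rw [cooperativeValue_eq α β ρ i V s hj.symm]
    exact (hV s).symm
  rw [expectedUtility_eq hδ₀.le, expectedUtility_eq hδ₀.le, ← hρ]
  refine (tsum_expectedRoundUtility_le hα₀ hα₁ hβ₀.le hβ₁ hρ₀.le hρ₁ i hVb ?_).trans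
    (le_tsum_expectedRoundUtility hα₀ hα₁ hβ₀.le hβ₁ hρ₀.le hρ₁ i hVb ?_)
  · intro x hx
    rw [hs₀] at hx
    rw [← hcoop (money s₀ x)]
    refine deviation_le_cooperativeValue hα₀ hβ₀.le hβ₁ τ hx fun p k hp hpi hk => ?_
    refine le_value_sub hα₀ hα₁ hc hρ₀ hρ₁.le hθ₀ hθ₁ (div_mul_cancel₀ _ hden₀.ne') hMn hn hV
      hVinv ((sum_pay hp i).trans hx) ((sum_pay hp k).trans hx) ?_ hα
    rw [pay_apply_server hpi.symm, pay_apply_of_ne hpi.symm hk.symm]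
  · intro x hx
    rw [hs₀] at hx
    rw [sum_roundProb_threshold i hx, hcoop]

/-- The right-hand side is continuous at δ = 1 with value 1. The midpoint of α and 1 leaves the
other half of the gap to the oscillation error. -/
lemma exists_lt_discounted {α β : ℝ} (hα : α < 1) (hβ : 0 < β) (M : ℕ) :
    ∃ l : ℝ, l < 1 ∧ ∀ δ, l < δ → δ < 1 →
      (1 + α) / 2 < δ * (δ * (β / (β - Real.log δ))) ^ M := by
  have hc : ContinuousAt (fun δ : ℝ => δ * (δ * (β / (β - Real.log δ))) ^ M) 1 := by
    have h1 : ContinuousAt Real.log 1 := Real.continuousAt_log one_ne_zero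
    have h2 : β - Real.log 1 ≠ 0 := by simpa using hβ.ne'
    exact continuousAt_id.mul ((continuousAt_id.mul
      (continuousAt_const.div (continuousAt_const.sub h1) h2)).pow M)
  have h1 : (1 + α) / 2 < (fun δ : ℝ => δ * (δ * (β / (β - Real.log δ))) ^ M) 1 := by
    simp [hβ.ne']
    linarith
  have h := (hc.eventually_const_lt h1).filter_mono (nhdsWithin_le_nhds (s := Set.Iio 1))
  obtain ⟨l, hl, hl'⟩ := (mem_nhdsLT_iff_exists_Ioo_subset).1 h
  exact ⟨l, hl, fun δ h₁ h₂ => hl' ⟨h₁, h₂⟩⟩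

end Play

end ScripGame

theorem mainTheorem1 (α β : ℝ) (hα₀ : 0 ≤ α) (hα₁ : α < 1) (hβ₀ : 0 < β) (hβ₁ : β ≤ 1)
    (M : ℕ) (hM : 0 < M) :
    ∃ δstar : ℝ, δstar < 1 ∧ ∃ nstar : ℕ,
      ∀ δ : ℝ, δstar < δ → δ < 1 → ∀ n : ℕ, nstar < n →
        ∃ γ : ℕ, 0 < γ ∧
          ∀ s₀ : ScripGame.Alloc n, ∑ i, s₀ i = M →
            ScripGame.IsNashEquilibrium δ α β s₀
              (fun i : Fin n => ScripGame.threshold γ i) := by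
  obtain ⟨l, hl, hl'⟩ := ScripGame.exists_lt_discounted hα₁ hβ₀ M
  -- The ceiling makes the error 4M²/(n - 1 - 2M²) at most (1 - α)/2, the summand M gives M < n, and
  -- the 0 in the maximum keeps δ positive.
  refine ⟨max l 0, max_lt hl one_pos, ⌈8 * (M : ℝ) ^ 2 / (1 - α)⌉₊ + 2 * M ^ 2 + M + 1,
    fun δ hδ hδ₁ n hn => ⟨M, hM, fun s₀ hs₀ => ?_⟩⟩
  have hα : 0 < 1 - α := sub_pos.2 hα₁
  have hMpos : (0 : ℝ) < M := by exact_mod_cast hM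
  have h1 : 8 * (M : ℝ) ^ 2 / (1 - α) ≤ n - 1 - 2 * M ^ 2 := by
    have h2 := Nat.le_ceil (8 * (M : ℝ) ^ 2 / (1 - α))
    have h3 : ((⌈8 * (M : ℝ) ^ 2 / (1 - α)⌉₊ + 2 * M ^ 2 + M + 1 : ℕ) : ℝ) ≤ n := by
      exact_mod_cast hn.le
    push_cast at h3
    linarith
  have h0 : 0 < (n - 1 - 2 * M ^ 2 : ℝ) := lt_of_lt_of_le (by positivity) h1
  have h4 : 4 * (M : ℝ) ^ 2 / (n - 1 - 2 * M ^ 2) ≤ (1 - α) / 2 := by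
    rw [div_le_iff₀ hα] at h1
    rw [div_le_iff₀ h0]
    linarith
  have h5 := hl' δ ((le_max_left _ _).trans_lt hδ) hδ₁
  exact ScripGame.isNashEquilibrium_threshold hα₀ hα₁.le hβ₀ hβ₁ ((le_max_right _ _).trans_lt hδ)
    hδ₁ hM (by omega) h0 (by linarith) hs₀
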